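/- \textbf{Model.} Let $F\in\mathbb N$, $\lambda>0$, $\lambda_e\ge 0$, $D\ge 0$, $P>0$, $\alpha>2$, $\gamma_u>0$, and put $\delta=2/\alpha\in(0,1)$. The base stations (BSs) form a homogeneous Poisson point process $\Phi=\{X_n\}$ of density $\lambda$ in $\mathbb R^2$, the eavesdroppers a homogeneous Poisson point process $\Phi_e$ of density $\lambda_e$. The BSs carry marks, independent of one another and of all the BS locations; the mark of BS $n$ consists of three independent components: the set of files from $\{1,\dots,F\}$ that it caches, which contains file $i$ with probability $p_i$; an indicator of being active, equal to $1$ with the probability $\mathbb P(\Phi_e\cap \mathcal B(o,D)=\emptyset)$ that a guard disk of radius $D$ contains no eavesdropper (thinning by guard zones is thus taken to be independent from BS to BS; the indicator is modelled as a mark and not as a function of $\Phi_e$); and a Rayleigh fading gain $h_n\sim\mathrm{Exp}(1)$. For a file $i$ let $\Phi_{ai}$ be the set of active BSs that cache $i$, $\Phi_{\bar ai}$ the set of inactive BSs that cache $i$ (they send artificial noise), and $\Phi_i^c$ the set of BSs that do not cache $i$. A typical user at the origin that requests file $i$ is associated with $X_b=\arg\max_{X\in\Phi_{ai}}P\|X\|^{-\alpha}$,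 the nearest BS in $\Phi_{ai}$, and, receiver noise being neglected, its signal-to-interference ratio is $$\mathrm{SIR}(i)=\frac{P h_{X_b}\|X_b\|^{-\alpha}}{\sum_{X\in\Phi_i^c\cup\Phi_{\bar ai}}Ph_X\|X\|^{-\alpha}+\sum_{X\in\Phi_{ai}\setminus\{X_b\}}Ph_X\|X\|^{-\alpha}} .$$ The conditional hit probability of file $i$ is $\mathcal P_{ci}=\mathbb P(\Phi_{ai}\ne\emptyset,\ \mathrm{SIR}(i)>\gamma_u)$, and for a popularity distribution $(q_i)_{i=1}^F$ (such as the Zipf distribution) the average hit probability is $\mathcal P_c=\sum_{i=1}^F q_i\mathcal P_{ci}$. \textbf{Theorem.} In this model $$\mathcal P_c=\sum_{i=1}^F q_i\,\frac{p_i}{\tau_1(\gamma_u)\,p_i+\tau_2(\gamma_u)},$$ where $\tau_1(\gamma)=1+\kappa_2(\gamma)-\kappa_1(\gamma)$, $\tau_2(\gamma)=\kappa_1(\gamma)\exp(\pi\lambda_eD^2)$, $\kappa_1(\gamma)=\delta\gamma^\delta B(1-\delta,\delta)$, $\kappa_2(\gamma)=\frac{\delta\gamma}{1-\delta}\,{}_2F_1(1,1-\delta;2-\delta;-\gamma)$,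 $B$ is the beta function and ${}_2F_1$ the Gauss hypergeometric function (continued analytically to $(-\infty,1)$). -/

import Mathlib

open MeasureTheory ProbabilityTheory Set
open scoped ENNReal

noncomputable section

namespace CacheNet

/-- The Euclidean plane, in which the base stations and the eavesdroppers are located. -/
abbrev Plane : Type := EuclideanSpace ℝ (Fin 2)

/-! ### Poisson point processes -/

/-- `Φ` is a (simple) Poisson point process with intensity measure `Λ`: a random set of points such
that the number of points in a measurable set `B` of finite intensity is Poisson distributed with
mean `Λ B`, and the numbers of points in pairwise disjoint measurable sets are independent. -/
structure IsPoissonProcess {Ω E : Type*} [MeasurableSpace Ω] [MeasurableSpace E]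
    (μ : Measure Ω) (Φ : Ω → Set E) (Λ : Measure E) : Prop where
  measurable_count : ∀ B : Set E, MeasurableSet B → Measurable fun ω => (Φ ω ∩ B).encard
  count_law : ∀ B : Set E, MeasurableSet B → Λ B ≠ ∞ → ∀ k : ℕ,
    μ {ω | (Φ ω ∩ B).encard = k} = poissonMeasure (Λ B).toNNReal {k}
  indep_count : ∀ (m : ℕ) (B : Fin m → Set E), (∀ j, MeasurableSet (B j)) →
    Pairwise (fun j k => Disjoint (B j) (B k)) →
    iIndepFun (fun j ω => (Φ ω ∩ B j).encard) μ

/-- Homogeneous Poisson point process in the plane with density `lam`. -/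
def IsHomogeneousPPP {Ω : Type*} [MeasurableSpace Ω] (μ : Measure Ω) (Φ : Ω → Set Plane)
    (lam : ℝ) : Prop :=
  IsPoissonProcess μ Φ (ENNReal.ofReal lam • (volume : Measure Plane))

/-! ### The network -/

/-- The cache-enabled network as seen from a typical user at the origin.

* `X n` is the location of the `n`-th base station; the set of all locations is a homogeneous
  Poisson process with density `lam` (infinite almost surely, hence indexed by `ℕ`);
* `Φe` is the homogeneous Poisson process of eavesdroppers, with density `lamE`;
* `cache n` is the set of files stored by base station `n`; it contains file `i` with
  probability `p i`;
* `active n` tells whether base station `n` transmits files (`true`) or artificial noise (`false`).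
  Each base station is active independently of all the others, with the probability that a guard
  disk of radius `D` contains no eavesdropper (this is the independent-thinning model; by
  stationarity of `Φe` the centre of the disk is immaterial);
* `h n` is the Rayleigh fading power gain, exponentially distributed with mean one.

The marks `(cache n, active n, h n)` of different base stations are independent of one another and
of all the locations, and the three components of a mark are independent. The joint law of the
events `i ∈ cache n` for different files `i` is arbitrary. -/
structure IsNetwork {Ω : Type*} [MeasurableSpace Ω] (μ : Measure Ω) {F : ℕ}
    (lam lamE D : ℝ) (p : Fin F → ℝ) (X : ℕ → Ω → Plane) (Φe : Ω → Set Plane)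
    (cache : ℕ → Ω → Set (Fin F)) (active : ℕ → Ω → Bool) (h : ℕ → Ω → ℝ) : Prop where
  measurable_loc : ∀ n, Measurable (X n)
  measurable_cache : ∀ n, Measurable (cache n)
  measurable_active : ∀ n, Measurable (active n)
  measurable_fading : ∀ n, Measurable (h n)
  loc_injective : ∀ᵐ ω ∂μ, Function.Injective fun n => X n ω
  loc_ppp : IsHomogeneousPPP μ (fun ω => range fun n => X n ω) lam
  eve_ppp : IsHomogeneousPPP μ Φe lamE
  cache_prob : ∀ n i, μ.real {ω | i ∈ cache n ω} = p i
  active_prob : ∀ n, μ.real {ω | active n ω = true} =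
    μ.real {ω | Φe ω ∩ Metric.closedBall 0 D = ∅}
  fading_law : ∀ n, μ.map (h n) = expMeasure 1
  indep_loc_marks : IndepFun (fun ω n => X n ω) (fun ω n => (cache n ω, active n ω, h n ω)) μ
  indep_marks : iIndepFun (fun n ω => (cache n ω, active n ω, h n ω)) μ
  indep_cache : ∀ n, IndepFun (cache n) (fun ω => (active n ω, h n ω)) μ
  indep_active : ∀ n, IndepFun (active n) (h n) μ

section SIR

variable {F : ℕ}

/-- Indices of the base stations that transmit file `i`: they store it and are active. -/
def transmitters (cache : ℕ → Set (Fin F)) (active : ℕ → Bool) (i : Fin F) : Set ℕ :=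
  {n | i ∈ cache n ∧ active n = true}

/-- Indices of the base stations that store file `i` but send artificial noise. -/
def jammers (cache : ℕ → Set (Fin F)) (active : ℕ → Bool) (i : Fin F) : Set ℕ :=
  {n | i ∈ cache n ∧ active n = false}

/-- Indices of the base stations that do not store file `i`. -/
def nonCaching (cache : ℕ → Set (Fin F)) (i : Fin F) : Set ℕ :=
  {n | i ∉ cache n}

/-- The power received at the origin from a transmitter with power `P` and fading gain `g` located
at `x`, where `α` is the path-loss exponent. -/
def receivedPower (P α g : ℝ) (x : Plane) : ℝ≥0∞ :=
  ENNReal.ofReal (P * g * ‖x‖ ^ (-α))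

/-- `b` is the base station with which a user at the origin requesting file `i` is associated:
it maximizes the average received power `P ‖X‖ ^ (-α)` among the transmitters of file `i`. -/
def IsServing (P α : ℝ) (x : ℕ → Plane) (cache : ℕ → Set (Fin F)) (active : ℕ → Bool)
    (i : Fin F) (b : ℕ) : Prop :=
  b ∈ transmitters cache active i ∧
    ∀ n ∈ transmitters cache active i, P * ‖x n‖ ^ (-α) ≤ P * ‖x b‖ ^ (-α)

/-- The interference at the origin for a user requesting file `i` and served by `b`: the base
stations sending other files or artificial noise, and the other transmitters of file `i`. -/
def interference (P α : ℝ) (x : ℕ → Plane) (cache : ℕ → Set (Fin F)) (active : ℕ → Bool)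
    (g : ℕ → ℝ) (i : Fin F) (b : ℕ) : ℝ≥0∞ :=
  (∑' n : ↥(nonCaching cache i ∪ jammers cache active i), receivedPower P α (g n) (x n)) +
    ∑' n : ↥(transmitters cache active i \ {b}), receivedPower P α (g n) (x n)

/-- The signal-to-interference ratio (no receiver noise). -/
def SIR (P α : ℝ) (x : ℕ → Plane) (cache : ℕ → Set (Fin F)) (active : ℕ → Bool)
    (g : ℕ → ℝ) (i : Fin F) (b : ℕ) : ℝ≥0∞ :=
  receivedPower P α (g b) (x b) / interference P α x cache active g i b

end SIR

section HitProbability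

variable {Ω : Type*} [MeasurableSpace Ω] (μ : Measure Ω) {F : ℕ} (P α γ : ℝ)
  (X : ℕ → Ω → Plane) (cache : ℕ → Ω → Set (Fin F)) (active : ℕ → Ω → Bool) (h : ℕ → Ω → ℝ)

/-- The conditional hit probability of file `i`: the probability that the typical user requesting
file `i` has a serving base station and that its SIR exceeds the target `γ`. -/
def condHitProbability (i : Fin F) : ℝ :=
  μ.real {ω | ∃ b : ℕ,
    IsServing P α (fun n => X n ω) (fun n => cache n ω) (fun n => active n ω) i b ∧
    ENNReal.ofReal γ <
      SIR P α (fun n => X n ω) (fun n => cache n ω) (fun n => active n ω) (fun n => h n ω) i b}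

/-- The average hit probability under the popularity distribution `q`. -/
def hitProbability (q : Fin F → ℝ) : ℝ :=
  ∑ i, q i * condHitProbability μ P α γ X cache active h i

end HitProbability

/-! ### Special functions -/

/-- `f` is the analytic continuation to `(-∞, 1)` of the Gauss hypergeometric series
`∑ (a)ₙ (b)ₙ / (c)ₙ xⁿ / n!`, which converges on `(-1, 1)`. -/
def IsGaussContinuation (a b c : ℝ) (f : ℝ → ℝ) : Prop :=
  AnalyticOnNhd ℝ f (Iio 1) ∧ EqOn f (ordinaryHypergeometric a b c) (Ioo (-1) 1)

/-- The continuation is unique. -/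
theorem IsGaussContinuation.eqOn {a b c : ℝ} {f g : ℝ → ℝ} (hf : IsGaussContinuation a b c f)
    (hg : IsGaussContinuation a b c g) : EqOn f g (Iio 1) := by
  refine hf.1.eqOn_of_preconnected_of_eventuallyEq hg.1 isPreconnected_Iio
    (z₀ := 0) (by simp) ?_
  filter_upwards [Ioo_mem_nhds (show (-1 : ℝ) < 0 by norm_num) (show (0 : ℝ) < 1 by norm_num)]
    with x hx
  rw [hf.2 hx, hg.2 hx]

open Classical in
/-- The Gauss hypergeometric function `₂F₁(a, b; c; x)` for real parameters and real `x < 1`: the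
analytic continuation of the Gauss hypergeometric series. -/
def gaussHypergeometric (a b c x : ℝ) : ℝ :=
  if hex : ∃ f : ℝ → ℝ, IsGaussContinuation a b c f then hex.choose x else 0

theorem gaussHypergeometric_eq {a b c : ℝ} {f : ℝ → ℝ} (hf : IsGaussContinuation a b c f)
    {x : ℝ} (hx : x < 1) : gaussHypergeometric a b c x = f x := by
  have hex : ∃ f : ℝ → ℝ, IsGaussContinuation a b c f := ⟨f, hf⟩
  rw [gaussHypergeometric, dif_pos hex]
  exact hex.choose_spec.eqOn hf hx

/-- `κ₁(γ) = δ γ^δ B(1 - δ, δ)`, with `B` the beta function. -/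
def kappa1 (δ γ : ℝ) : ℝ := δ * γ ^ δ * ProbabilityTheory.beta (1 - δ) δ

/-- `κ₂(γ) = δ γ / (1 - δ) · ₂F₁(1, 1 - δ; 2 - δ; -γ)`. -/
def kappa2 (δ γ : ℝ) : ℝ := δ * γ / (1 - δ) * gaussHypergeometric 1 (1 - δ) (2 - δ) (-γ)

/-- `τ₁(γ) = 1 + κ₂(γ) - κ₁(γ)`. -/
def tau1 (δ γ : ℝ) : ℝ := 1 + kappa2 δ γ - kappa1 δ γ

/-- `τ₂(γ) = κ₁(γ) exp(π λₑ D²)`. -/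
def tau2 (δ lamE D γ : ℝ) : ℝ := kappa1 δ γ * Real.exp (Real.pi * lamE * D ^ 2)

end CacheNet

end

/-! Fix a file and freeze the locations. Each station transmits the file independently with
probability `a = p i * exp (-π λₑ D²)`. The user is hit through station `b` iff `b` transmits, no
nearer station does, and the gain of `b` exceeds the normalized interference. The exponential tail
turns the last condition into a Laplace transform, and independence of the marks gives the
probability `a` times the product over `n ≠ b` of `hitFactor` at the distances of `b` and `n`
(`IsNetwork.measure_isHitBy`).

It remains to sum over `b` and average over the Poisson process. Heuristically, a server at distance
`r` contributes `a` times the probability generating functional, `exp (-λ ∫ (1 - hitFactor))`. Polar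
coordinates and a power substitution give `∫ (1 - hitFactor) = π r² C` with `C = a τ₁ + κ₁`
(`lintegral_one_sub_hitFactor`). So the answer is `∫ 2πλ r a exp (-λ π r² C) dr = a / C`, which is
the claimed fraction once the thinning probability is cancelled.

Campbell–Mecke calculus is replaced by a discretization. The plane is cut into annuli of intensity
`ε`. Since `hitFactor` decreases in the serving distance, that distance may be rounded to the inner
radius (upper bound) or to the outer radius (lower bound). Factors from the server's own annulus are
discarded in the upper bound; the lower bound keeps only annuli with exactly one point. The count in
an annulus is then independent of the product over the points outside it
(`lintegral_count_mul_infProd`), both bounds are geometric series, and both tend to `a / C` as `ε →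
0` (`IsNetwork.hitProb_le`, `IsNetwork.le_hitProb`). -/

noncomputable section

open Filter Topology

namespace CacheNet

/-! ### Infinite products of numbers in `[0, 1]` -/

/-- The infimum of the partial products, which is the infinite product if all factors are at
most one. -/
def infProd (f : ℕ → ℝ≥0∞) : ℝ≥0∞ := ⨅ N, ∏ n ∈ Finset.range N, f n

theorem antitone_prod_range {f : ℕ → ℝ≥0∞} (hf : ∀ n, f n ≤ 1) :
    Antitone fun N => ∏ n ∈ Finset.range N, f n :=
  antitone_nat_of_succ_le fun N => by
    rw [Finset.prod_range_succ]
    exact mul_le_of_le_one_right' (hf N)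

theorem tendsto_infProd {f : ℕ → ℝ≥0∞} (hf : ∀ n, f n ≤ 1) :
    Tendsto (fun N => ∏ n ∈ Finset.range N, f n) atTop (𝓝 (infProd f)) :=
  tendsto_atTop_iInf (antitone_prod_range hf)

theorem infProd_mono {f g : ℕ → ℝ≥0∞} (h : ∀ n, f n ≤ g n) : infProd f ≤ infProd g :=
  iInf_mono fun _ => Finset.prod_le_prod' fun n _ => h n

theorem infProd_le_one (f : ℕ → ℝ≥0∞) : infProd f ≤ 1 :=
  (iInf_le _ 0).trans (by simp)

theorem measurable_infProd {Ω : Type*} [MeasurableSpace Ω] {f : ℕ → Ω → ℝ≥0∞}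
    (hf : ∀ n, Measurable (f n)) : Measurable fun ω => infProd fun n => f n ω :=
  Measurable.iInf fun _ => Finset.measurable_fun_prod _ fun n _ => hf n

theorem infProd_mul {f g : ℕ → ℝ≥0∞} (hf : ∀ n, f n ≤ 1) (hg : ∀ n, g n ≤ 1) :
    infProd (fun n => f n * g n) = infProd f * infProd g := by
  have h1 := tendsto_infProd (f := fun n => f n * g n) fun n => mul_le_one' (hf n) (hg n)
  have h2 := ENNReal.Tendsto.mul (tendsto_infProd hf)
    (Or.inr ((infProd_le_one g).trans_lt ENNReal.one_lt_top).ne) (tendsto_infProd hg)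
    (Or.inr ((infProd_le_one f).trans_lt ENNReal.one_lt_top).ne)
  simp only [Finset.prod_mul_distrib] at h1
  exact tendsto_nhds_unique h1 h2

theorem infProd_finset_prod {ι : Type*} (s : Finset ι) (f : ι → ℕ → ℝ≥0∞)
    (hf : ∀ i n, f i n ≤ 1) :
    infProd (fun n => ∏ i ∈ s, f i n) = ∏ i ∈ s, infProd (f i) := by
  classical
  induction s using Finset.induction_on with
  | empty => simp [infProd]
  | insert i s hi ih =>
    simp only [Finset.prod_insert hi]
    rw [infProd_mul (hf i) fun n => Finset.prod_le_one' fun j _ => hf j n, ih]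

/-- Infima commute, and a finite product is continuous where its factors are finite. This carries
the generating functional from simple functions to measurable ones. -/
theorem infProd_iInf {f : ℕ → ℕ → ℝ≥0∞} (hf : ∀ m n, f m n ≤ 1)
    (hanti : ∀ n, Antitone fun m => f m n) :
    infProd (fun n => ⨅ m, f m n) = ⨅ m, infProd (f m) := by
  unfold infProd
  rw [iInf_comm]
  refine iInf_congr fun N => ?_
  have h1 : Tendsto (fun m => ∏ n ∈ Finset.range N, f m n) atTop
      (𝓝 (∏ n ∈ Finset.range N, ⨅ m, f m n)) :=
    ENNReal.tendsto_finsetProd_of_ne_top _ (fun n _ => tendsto_atTop_iInf (hanti n))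
      fun n _ => ((iInf_le _ 0).trans (hf 0 n) |>.trans_lt ENNReal.one_lt_top).ne
  exact tendsto_nhds_unique h1
    (tendsto_atTop_iInf fun m m' h => Finset.prod_le_prod' fun n _ => hanti n h)

/-- `c ^ k`, with `c ^ ∞ = 0`. -/
def enatPow (c : ℝ≥0∞) (k : ℕ∞) : ℝ≥0∞ := if k = ⊤ then 0 else c ^ k.toNat

/-- The partial products are eventually constant. Finiteness of `S` matters for `c = 1`, where
`enatPow 1 ⊤ = 0` differs from the product. -/
theorem infProd_ite_mem {S : Set ℕ} [DecidablePred (· ∈ S)] (hS : S.Finite) {c : ℝ≥0∞}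
    (hc : c ≤ 1) : infProd (fun n => if n ∈ S then c else 1) = enatPow c S.encard := by
  obtain ⟨M, hM⟩ := hS.bddAbove
  have h1 := tendsto_infProd (f := fun n => if n ∈ S then c else 1)
    fun n => by split_ifs <;> simp [hc]
  refine tendsto_nhds_unique h1 (tendsto_const_nhds.congr' ?_)
  filter_upwards [eventually_gt_atTop M] with N hN
  have h2 : (Finset.range N).filter (· ∈ S) = hS.toFinset := by
    ext n
    simp only [Finset.mem_filter, Finset.mem_range, Set.Finite.mem_toFinset, and_iff_right_iff_imp]
    exact fun hn => (hM hn).trans_lt hN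
  rw [Finset.prod_ite, h2, Finset.prod_const, Finset.prod_const_one, mul_one, enatPow,
    if_neg (Set.encard_ne_top_iff.2 hS), hS.encard_eq_coe_toFinset_card]
  simp

/-- The expectation of an infinite product of independent factors in `[0, 1]`. -/
theorem lintegral_infProd {Ω : Type*} [MeasurableSpace Ω] {μ : Measure Ω} [IsProbabilityMeasure μ]
    {Y : ℕ → Ω → ℝ≥0∞} (hY : iIndepFun Y μ) (hm : ∀ n, Measurable (Y n)) (h1 : ∀ n ω, Y n ω ≤ 1) :
    ∫⁻ ω, infProd (fun n => Y n ω) ∂μ = infProd fun n => ∫⁻ ω, Y n ω ∂μ := by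
  unfold infProd
  rw [lintegral_iInf]
  · exact iInf_congr fun N => lintegral_prod_eq_prod_lintegral_of_indepFun _ _ hY hm
  · exact fun N => Finset.measurable_fun_prod _ fun n _ => hm n
  · exact fun N M h ω => antitone_prod_range (fun n => h1 n ω) h
  · simp

/-! ### The exponential of a negative extended number -/

/-- `exp (-y)`, with `exp (-∞) = 0`. -/
def expNeg (y : ℝ≥0∞) : ℝ≥0∞ := EReal.exp (-(y : EReal))

theorem expNeg_ofReal {y : ℝ} (hy : 0 ≤ y) :
    expNeg (ENNReal.ofReal y) = ENNReal.ofReal (Real.exp (-y)) := by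
  rw [expNeg, EReal.coe_ennreal_ofReal, max_eq_left hy, ← EReal.coe_neg, EReal.exp_coe]

@[simp] theorem expNeg_zero : expNeg 0 = 1 := by simp [expNeg]

@[simp] theorem expNeg_top : expNeg ∞ = 0 := by simp [expNeg]

theorem antitone_expNeg : Antitone expNeg := fun a b h => by
  unfold expNeg
  rw [EReal.exp_le_exp_iff, EReal.neg_le_neg_iff]
  exact_mod_cast h

theorem expNeg_le_one (y : ℝ≥0∞) : expNeg y ≤ 1 := by
  rw [← expNeg_zero]
  exact antitone_expNeg zero_le

theorem continuous_expNeg : Continuous expNeg :=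
  ENNReal.continuous_exp.comp (continuous_neg.comp continuous_coe_ennreal_ereal)

theorem measurable_expNeg : Measurable expNeg := continuous_expNeg.measurable

theorem expNeg_add (a b : ℝ≥0∞) : expNeg (a + b) = expNeg a * expNeg b := by
  unfold expNeg
  rw [← EReal.exp_add, EReal.coe_ennreal_add, EReal.neg_add, sub_eq_add_neg]
  · left; simp
  · right; simp

theorem expNeg_sum {ι : Type*} (s : Finset ι) (y : ι → ℝ≥0∞) :
    expNeg (∑ i ∈ s, y i) = ∏ i ∈ s, expNeg (y i) := by
  classical
  induction s using Finset.induction_on with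
  | empty => simp
  | insert i s hi ih => rw [Finset.sum_insert hi, Finset.prod_insert hi, expNeg_add, ih]

theorem expNeg_iSup (y : ℕ → ℝ≥0∞) : expNeg (⨆ n, y n) = ⨅ n, expNeg (y n) :=
  Antitone.map_ciSup_of_continuousAt (f := expNeg) continuous_expNeg.continuousAt antitone_expNeg
    (OrderTop.bddAbove _)

theorem expNeg_tsum (y : ℕ → ℝ≥0∞) : expNeg (∑' n, y n) = infProd fun n => expNeg (y n) := by
  rw [ENNReal.tsum_eq_iSup_nat, expNeg_iSup]
  exact iInf_congr fun N => expNeg_sum _ _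

/-! ### Poisson processes -/

section Poisson

variable {Ω E : Type*} [MeasurableSpace Ω] [MeasurableSpace E] {μ : Measure Ω}
  {Φ : Ω → Set E} {Λ : Measure E}

/-- The Poisson weights of the finite counts already sum to one. -/
theorem IsPoissonProcess.ae_ne_top [IsProbabilityMeasure μ] (hΦ : IsPoissonProcess μ Φ Λ)
    {B : Set E} (hB : MeasurableSet B) (hfin : Λ B ≠ ∞) : ∀ᵐ ω ∂μ, (Φ ω ∩ B).encard ≠ ⊤ := by
  have hms : ∀ k : ℕ, MeasurableSet {ω | (Φ ω ∩ B).encard = k} := fun k =>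
    hΦ.measurable_count B hB (measurableSet_singleton _)
  have h1 : μ (⋃ k : ℕ, {ω | (Φ ω ∩ B).encard = k}) = 1 := by
    rw [measure_iUnion _ hms]
    · simp_rw [hΦ.count_law B hB hfin]
      rw [← measure_iUnion, Set.iUnion_singleton_eq_range, Set.range_id', measure_univ]
      · exact fun i j hij => by simpa using hij
      · exact fun i => measurableSet_singleton _
    · intro i j hij
      refine Set.disjoint_left.2 fun ω (hi : _ = _) (hj : _ = _) => hij ?_
      exact_mod_cast hi.symm.trans hj
  rw [← prob_compl_eq_zero_iff (MeasurableSet.iUnion hms)] at h1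
  refine measure_mono_null (fun ω hω => ?_) h1
  simp only [Set.mem_compl_iff, Set.mem_ofPred_eq, not_not, Set.mem_iUnion, not_exists] at hω ⊢
  simp [hω]

/-- The law of the number of points in a set of finite intensity. -/
theorem IsPoissonProcess.map_count [IsProbabilityMeasure μ] (hΦ : IsPoissonProcess μ Φ Λ)
    {B : Set E} (hB : MeasurableSet B) (hfin : Λ B ≠ ∞) :
    μ.map (fun ω => (Φ ω ∩ B).encard) =
      (poissonMeasure (Λ B).toNNReal).map (fun k : ℕ => (k : ℕ∞)) := by
  refine Measure.ext_of_singleton fun k => ?_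
  rw [Measure.map_apply (hΦ.measurable_count B hB) (measurableSet_singleton _),
    Measure.map_apply (measurable_of_countable _) (measurableSet_singleton _)]
  induction k using ENat.recTopCoe with
  | top =>
    have h0 : (fun k : ℕ => (k : ℕ∞)) ⁻¹' {⊤} = ∅ := by ext; simp
    have h1 := ae_iff.1 (hΦ.ae_ne_top hB hfin)
    simp only [not_not] at h1
    rw [h0, measure_empty]
    exact h1
  | coe k =>
    have h0 : (fun k : ℕ => (k : ℕ∞)) ⁻¹' {(k : ℕ∞)} = {k} := by ext; simp
    rw [h0]
    exact hΦ.count_law B hB hfin k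

theorem IsPoissonProcess.lintegral_count [IsProbabilityMeasure μ] (hΦ : IsPoissonProcess μ Φ Λ)
    {B : Set E} (hB : MeasurableSet B) (hfin : Λ B ≠ ∞) (ψ : ℕ∞ → ℝ≥0∞) :
    ∫⁻ ω, ψ (Φ ω ∩ B).encard ∂μ =
      ∑' k : ℕ, ψ k * ENNReal.ofReal
        (Real.exp (-(Λ B).toReal) * (Λ B).toReal ^ k / (Nat.factorial k)) := by
  rw [← lintegral_map (f := ψ) (measurable_of_countable _) (hΦ.measurable_count B hB),
    hΦ.map_count hB hfin, lintegral_map (measurable_of_countable _) (measurable_of_countable _),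
    lintegral_countable']
  simp_rw [poissonMeasure_singleton]
  rfl

/-- Generating function of the Poisson law: the exponential series at `(1 - c) Λ B` times `exp (-Λ
B)`. -/
theorem IsPoissonProcess.lintegral_enatPow [IsProbabilityMeasure μ] (hΦ : IsPoissonProcess μ Φ Λ)
    {B : Set E} (hB : MeasurableSet B) (hfin : Λ B ≠ ∞) {c : ℝ≥0∞} (hc : c ≤ 1) :
    ∫⁻ ω, enatPow (1 - c) (Φ ω ∩ B).encard ∂μ = expNeg (c * Λ B) := by
  rw [hΦ.lintegral_count hB hfin]
  lift c to NNReal using (hc.trans_lt ENNReal.one_lt_top).ne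
  lift Λ B to NNReal using hfin with r
  have hc' : (c : ℝ) ≤ 1 := by exact_mod_cast hc
  have h1 : (1 : ℝ≥0∞) - c = ENNReal.ofReal (1 - c) := by
    rw [ENNReal.ofReal_sub _ c.coe_nonneg]; simp
  have h2 : ∀ k : ℕ, enatPow (1 - c) k * ENNReal.ofReal
      (Real.exp (-(r : ℝ≥0∞).toReal) * (r : ℝ≥0∞).toReal ^ k / (Nat.factorial k)) =
      ENNReal.ofReal (Real.exp (-r) * (((1 - c) * r) ^ k / (Nat.factorial k))) := by
    intro k
    rw [enatPow, if_neg (ENat.natCast_ne_top k), ENat.toNat_natCast, h1,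
      ← ENNReal.ofReal_pow (by linarith), ← ENNReal.ofReal_mul (by
        have : 0 ≤ 1 - (c : ℝ) := by linarith
        positivity), ENNReal.coe_toReal]
    congr 1
    rw [mul_pow]
    ring
  have h3 : HasSum (fun k : ℕ => Real.exp (-r) * (((1 - c) * r) ^ k / (Nat.factorial k) : ℝ))
      (Real.exp (-r) * Real.exp ((1 - c) * r)) := by
    rw [Real.exp_eq_exp_ℝ]
    exact (NormedSpace.expSeries_div_hasSum_exp ((1 - c) * r : ℝ)).mul_left _
  have hn : 0 ≤ 1 - (c : ℝ) := by linarith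
  rw [tsum_congr h2, ← ENNReal.ofReal_tsum_of_nonneg (fun k => by positivity) h3.summable,
    h3.tsum_eq, ← Real.exp_add]
  have h4 : (c : ℝ≥0∞) * r = ENNReal.ofReal (c * r) := by
    rw [ENNReal.ofReal_mul c.coe_nonneg]; simp
  rw [h4, expNeg_ofReal (by positivity)]
  congr 2
  ring

theorem IsPoissonProcess.lintegral_encard [IsProbabilityMeasure μ] (hΦ : IsPoissonProcess μ Φ Λ)
    {B : Set E} (hB : MeasurableSet B) (hfin : Λ B ≠ ∞) :
    ∫⁻ ω, ((Φ ω ∩ B).encard : ℝ≥0∞) ∂μ = Λ B := by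
  rw [hΦ.lintegral_count hB hfin (fun k => (k : ℝ≥0∞))]
  lift Λ B to NNReal using hfin with r
  rw [tsum_eq_zero_add' ENNReal.summable]
  have h2 : ∀ k : ℕ, (((k + 1 : ℕ) : ℕ∞) : ℝ≥0∞) * ENNReal.ofReal
      (Real.exp (-(r : ℝ≥0∞).toReal) * (r : ℝ≥0∞).toReal ^ (k + 1) / (Nat.factorial (k + 1))) =
      ENNReal.ofReal (r * Real.exp (-r) * (r ^ k / (Nat.factorial k))) := by
    intro k
    rw [ENat.toENNReal_coe, ← ENNReal.ofReal_natCast, ← ENNReal.ofReal_mul (by positivity),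
      ENNReal.coe_toReal]
    congr 1
    rw [Nat.factorial_succ]
    push_cast
    field_simp
    ring
  have h3 : HasSum (fun k : ℕ => r * Real.exp (-r) * (r ^ k / (Nat.factorial k) : ℝ))
      (r * Real.exp (-r) * Real.exp r) := by
    rw [Real.exp_eq_exp_ℝ]
    exact (NormedSpace.expSeries_div_hasSum_exp (r : ℝ)).mul_left _
  rw [tsum_congr h2, ← ENNReal.ofReal_tsum_of_nonneg (fun k => by positivity) h3.summable,
    h3.tsum_eq, mul_assoc, ← Real.exp_add]
  simp

theorem IsPoissonProcess.measure_count_eq_one (hΦ : IsPoissonProcess μ Φ Λ) {B : Set E}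
    (hB : MeasurableSet B) (hfin : Λ B ≠ ∞) :
    μ {ω | (Φ ω ∩ B).encard = 1} = Λ B * expNeg (Λ B) := by
  have h := hΦ.count_law B hB hfin 1
  rw [Nat.cast_one] at h
  rw [h, poissonMeasure_singleton]
  lift Λ B to NNReal using hfin with r
  have h4 : (r : ℝ≥0∞) = ENNReal.ofReal r := by simp
  rw [h4, expNeg_ofReal r.coe_nonneg, ← ENNReal.ofReal_mul r.coe_nonneg]
  simp [mul_comm]

theorem IsPoissonProcess.iIndepFun_count (hΦ : IsPoissonProcess μ Φ Λ) {ι : Type*} [Fintype ι]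
    {B : ι → Set E} (hB : ∀ i, MeasurableSet (B i))
    (hdisj : Pairwise fun i j => Disjoint (B i) (B j)) :
    iIndepFun (fun i ω => (Φ ω ∩ B i).encard) μ := by
  let e := Fintype.equivFin ι
  have h := (hΦ.indep_count _ (fun j => B (e.symm j)) (fun j => hB _)
    (fun i j hij => hdisj (e.symm.injective.ne hij))).precomp e.injective
  convert h using 1
  funext i ω
  simp

end Poisson

/-! ### The probability generating functional -/

theorem encard_range_inter {E : Type*} {x : ℕ → E} (hx : Function.Injective x) (B : Set E) :
    (range x ∩ B).encard = (x ⁻¹' B).encard := by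
  rw [← Set.image_preimage_eq_range_inter, hx.encard_image]

section Functional

variable {Ω E : Type*} [MeasurableSpace Ω] [MeasurableSpace E] {μ : Measure Ω}
  [IsProbabilityMeasure μ] {X : ℕ → Ω → E} {Λ : Measure E}

/-- Points are grouped by the value of `φ`. The value `0` is left out: it contributes only factors
one, and its level set may contain infinitely many points. -/
theorem infProd_simpleFunc {E : Type*} [MeasurableSpace E] {x : ℕ → E}
    (hx : Function.Injective x) (φ : SimpleFunc E ℝ≥0∞)
    (hfin : ∀ c ∈ φ.range, c ≠ 0 → (range x ∩ φ ⁻¹' {c}).encard ≠ ⊤) :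
    infProd (fun n => 1 - φ (x n)) =
      ∏ c : {c // c ∈ φ.range.filter (· ≠ 0)},
        enatPow (1 - c.1) (range x ∩ φ ⁻¹' {c.1}).encard := by
  classical
  rw [Finset.prod_coe_sort (φ.range.filter (· ≠ 0))
    fun c => enatPow (1 - c) (range x ∩ φ ⁻¹' {c}).encard]
  have h1 : ∀ c ∈ φ.range.filter (· ≠ 0), enatPow (1 - c) (range x ∩ φ ⁻¹' {c}).encard =
      infProd fun n => if n ∈ x ⁻¹' (φ ⁻¹' {c}) then 1 - c else 1 := by
    intro c hc
    rw [Finset.mem_filter] at hc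
    rw [infProd_ite_mem _ tsub_le_self, encard_range_inter hx]
    rw [← Set.encard_ne_top_iff, ← encard_range_inter hx]
    exact hfin c hc.1 hc.2
  rw [Finset.prod_congr rfl h1, ← infProd_finset_prod]
  · congr 1
    funext n
    have h2 : ∀ c, (n ∈ x ⁻¹' (φ ⁻¹' {c})) ↔ φ (x n) = c := fun c => Iff.rfl
    simp_rw [h2]
    rw [Finset.prod_ite_eq]
    split_ifs with h
    · rfl
    · have : φ (x n) = 0 := by
        by_contra h0
        exact h (Finset.mem_filter.2 ⟨φ.mem_range_self _, h0⟩)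
      simp [this]
  · intro c n
    split_ifs <;> simp

/-- `A` and the level sets of the nonzero values of `φ` are disjoint, so their counts are
independent. Each level set contributes `expNeg (c * Λ (φ ⁻¹' {c}))`, and the exponents add up to
the integral of `φ`. -/
theorem lintegral_count_mul_infProd_simpleFunc
    (hΦ : IsPoissonProcess μ (fun ω => range fun n => X n ω) Λ)
    (hinj : ∀ᵐ ω ∂μ, Function.Injective fun n => X n ω) {A : Set E} (hA : MeasurableSet A)
    (ψ : ℕ∞ → ℝ≥0∞) (φ : SimpleFunc E ℝ≥0∞) (hφ1 : ∀ y, φ y ≤ 1) (hφA : ∀ y ∈ A, φ y = 0)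
    (hφ : ∫⁻ y, φ y ∂Λ ≠ ∞) :
    ∫⁻ ω, ψ ((range fun n => X n ω) ∩ A).encard * infProd (fun n => 1 - φ (X n ω)) ∂μ =
      (∫⁻ ω, ψ ((range fun n => X n ω) ∩ A).encard ∂μ) * expNeg (∫⁻ y, φ y ∂Λ) := by
  classical
  let S := φ.range.filter (· ≠ 0)
  -- `none` stands for `A` with weight `ψ`, and `some c` for the level set of `c` with weight `(1 -
  -- c) ^ count`.
  let B : Option {c // c ∈ S} → Set E := fun o => o.elim A fun c => φ ⁻¹' {c.1}
  let w : Option {c // c ∈ S} → ℕ∞ → ℝ≥0∞ := fun o => o.elim ψ fun c => enatPow (1 - c.1)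
  have hB : ∀ o, MeasurableSet (B o) := by
    rintro (_ | c)
    · exact hA
    · exact φ.measurableSet_fiber _
  have hdisj : Pairwise fun i j => Disjoint (B i) (B j) := by
    have h1 : ∀ c : {c // c ∈ S}, Disjoint A (φ ⁻¹' {c.1}) := by
      refine fun c => Set.disjoint_left.2 fun y hy (hc : φ y = c.1) => ?_
      exact (Finset.mem_filter.1 c.2).2 (hc ▸ hφA y hy)
    rintro (_ | c) (_ | d) hcd
    · exact absurd rfl hcd
    · exact h1 d
    · exact (h1 c).symm
    · refine Set.disjoint_left.2 fun y (hc : φ y = c.1) (hd : φ y = d.1) => hcd ?_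
      rw [Subtype.ext (hc.symm.trans hd)]
  -- Markov's inequality: a level set of a nonzero value has finite intensity because `φ` is
  -- integrable.
  have hfin : ∀ c ∈ φ.range, c ≠ 0 → Λ (φ ⁻¹' {c}) ≠ ∞ := by
    intro c _ hc h
    refine hφ (top_le_iff.1 ?_)
    calc (∞ : ℝ≥0∞) = c * Λ (φ ⁻¹' {c}) := by rw [h, ENNReal.mul_top hc]
      _ = ∫⁻ y in φ ⁻¹' {c}, c ∂Λ := by rw [setLIntegral_const]
      _ = ∫⁻ y in φ ⁻¹' {c}, φ y ∂Λ :=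
        (setLIntegral_congr_fun (φ.measurableSet_fiber _) fun y (hy : φ y = c) => hy).symm
      _ ≤ _ := setLIntegral_le_lintegral _ _
  have hfin' : ∀ c : {c // c ∈ S}, Λ (φ ⁻¹' {c.1}) ≠ ∞ := fun c =>
    hfin _ (Finset.mem_filter.1 c.2).1 (Finset.mem_filter.1 c.2).2
  have hcount : ∀ᵐ ω ∂μ, ∀ c ∈ φ.range, c ≠ 0 →
      ((range fun n => X n ω) ∩ φ ⁻¹' {c}).encard ≠ ⊤ := by
    rw [Filter.eventually_all_finset]
    intro c hc
    by_cases h0 : c = 0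
    · simp [h0]
    · filter_upwards [hΦ.ae_ne_top (φ.measurableSet_fiber c) (hfin c hc h0)] with ω hω _
      exact hω
  have hind : iIndepFun (fun o ω => w o ((range fun n => X n ω) ∩ B o).encard) μ :=
    (hΦ.iIndepFun_count hB hdisj).comp w fun o => measurable_of_countable _
  have hmeas : ∀ o, Measurable fun ω => w o ((range fun n => X n ω) ∩ B o).encard := fun o =>
    (measurable_of_countable _).comp (hΦ.measurable_count _ (hB o))
  have hprod := lintegral_prod_eq_prod_lintegral_of_indepFun Finset.univ _ hind hmeas
  simp only [Fintype.prod_option] at hprod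
  calc _ = ∫⁻ ω, w none ((range fun n => X n ω) ∩ B none).encard *
        ∏ c, w (some c) ((range fun n => X n ω) ∩ B (some c)).encard ∂μ := by
        refine lintegral_congr_ae ?_
        filter_upwards [hinj, hcount] with ω h1 h2
        rw [infProd_simpleFunc h1 φ h2]
        rfl
    _ = _ := hprod
    _ = (∫⁻ ω, ψ ((range fun n => X n ω) ∩ A).encard ∂μ) *
        ∏ c : {c // c ∈ S}, expNeg (c * Λ (φ ⁻¹' {c.1})) := by
        congr 1
        refine Finset.prod_congr rfl fun c _ => ?_
        obtain ⟨y, hy⟩ := φ.mem_range.1 (Finset.mem_filter.1 c.2).1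
        exact hΦ.lintegral_enatPow (φ.measurableSet_fiber _) (hfin' c) (hy ▸ hφ1 y)
    _ = _ := by
        rw [← expNeg_sum, Finset.sum_coe_sort S fun c => c * Λ (φ ⁻¹' {c}),
          SimpleFunc.lintegral_eq_lintegral, SimpleFunc.lintegral]
        congr 2
        refine Finset.sum_subset (Finset.filter_subset _ _) fun c hc hcS => ?_
        have : c = 0 := by
          by_contra h0
          exact hcS (Finset.mem_filter.2 ⟨hc, h0⟩)
        simp [this]

/-- The probability generating functional of a Poisson process, weighted by a function of the
number of points in a set on which the argument of the functional is trivial. -/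
theorem lintegral_count_mul_infProd
    (hΦ : IsPoissonProcess μ (fun ω => range fun n => X n ω) Λ) (hX : ∀ n, Measurable (X n))
    (hinj : ∀ᵐ ω ∂μ, Function.Injective fun n => X n ω) {A : Set E} (hA : MeasurableSet A)
    (ψ : ℕ∞ → ℝ≥0∞) (hψ : ∫⁻ ω, ψ ((range fun n => X n ω) ∩ A).encard ∂μ ≠ ∞)
    {φ : E → ℝ≥0∞} (hm : Measurable φ) (hφ1 : ∀ y, φ y ≤ 1) (hφA : ∀ y ∈ A, φ y = 0)
    (hφ : ∫⁻ y, φ y ∂Λ ≠ ∞) :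
    ∫⁻ ω, ψ ((range fun n => X n ω) ∩ A).encard * infProd (fun n => 1 - φ (X n ω)) ∂μ =
      (∫⁻ ω, ψ ((range fun n => X n ω) ∩ A).encard ∂μ) * expNeg (∫⁻ y, φ y ∂Λ) := by
  let φs := SimpleFunc.eapprox φ
  have hle : ∀ m y, φs m y ≤ φ y := fun m y =>
    (le_iSup (fun m => φs m y) m).trans_eq (SimpleFunc.iSup_eapprox_apply hm y)
  have hmono : ∀ y, Monotone fun m => φs m y := fun y m m' h =>
    SimpleFunc.monotone_eapprox φ h y
  have hanti : ∀ ω, Antitone fun m => infProd fun n => 1 - φs m (X n ω) := fun ω m m' h =>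
    infProd_mono fun n => tsub_le_tsub_left (hmono _ h) _
  have h1 : ∀ ω, infProd (fun n => 1 - φ (X n ω)) = ⨅ m, infProd fun n => 1 - φs m (X n ω) := by
    intro ω
    rw [← infProd_iInf (fun m n => tsub_le_self) fun n m m' h =>
      tsub_le_tsub_left (hmono (X n ω) h) _]
    congr 1
    funext n
    rw [← ENNReal.sub_iSup ENNReal.one_ne_top, SimpleFunc.iSup_eapprox_apply hm]
  have hψm : Measurable fun ω => ψ ((range fun n => X n ω) ∩ A).encard :=
    (measurable_of_countable ψ).comp (hΦ.measurable_count A hA)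
  have hfm : ∀ m, Measurable fun ω =>
      ψ ((range fun n => X n ω) ∩ A).encard * infProd fun n => 1 - φs m (X n ω) := fun m =>
    hψm.mul (measurable_infProd fun n => measurable_const.sub ((φs m).measurable.comp (hX n)))
  have h2 : ∀ m, ∫⁻ ω, ψ ((range fun n => X n ω) ∩ A).encard *
      infProd (fun n => 1 - φs m (X n ω)) ∂μ =
      (∫⁻ ω, ψ ((range fun n => X n ω) ∩ A).encard ∂μ) * expNeg (∫⁻ y, φs m y ∂Λ) := fun m =>
    lintegral_count_mul_infProd_simpleFunc hΦ hinj hA ψ (φs m)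
      (fun y => (hle m y).trans (hφ1 y)) (fun y hy => le_zero_iff.1 ((hle m y).trans_eq (hφA y hy)))
      ((lintegral_mono (hle m)).trans_lt hφ.lt_top).ne
  have hbd : ∀ ω m, ψ ((range fun n => X n ω) ∩ A).encard *
      infProd (fun n => 1 - φs m (X n ω)) ≤ ψ ((range fun n => X n ω) ∩ A).encard := fun ω m =>
    mul_le_of_le_one_right' (infProd_le_one _)
  have hfin : ∀ᵐ ω ∂μ, ψ ((range fun n => X n ω) ∩ A).encard ≠ ∞ := by
    filter_upwards [ae_lt_top hψm hψ] with ω h using h.ne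
  -- Monotone convergence for a decreasing sequence; it needs a finite integral, which the bound by
  -- `ψ` provides.
  have h3 : ∫⁻ ω, ψ ((range fun n => X n ω) ∩ A).encard * infProd (fun n => 1 - φ (X n ω)) ∂μ =
      ⨅ m, ∫⁻ ω, ψ ((range fun n => X n ω) ∩ A).encard *
        infProd (fun n => 1 - φs m (X n ω)) ∂μ := by
    rw [← lintegral_iInf hfm (fun m m' h ω => mul_le_mul_right (hanti ω h) _)
      ((lintegral_mono fun ω => hbd ω 0).trans_lt hψ.lt_top).ne]
    refine lintegral_congr_ae ?_
    filter_upwards [hfin] with ω hω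
    rw [h1, ENNReal.mul_iInf fun h => absurd h hω]
  rw [h3]
  simp_rw [h2]
  rw [lintegral_congr fun y => (SimpleFunc.iSup_eapprox_apply hm y).symm,
    lintegral_iSup (fun m => (φs m).measurable) fun m m' h y => hmono y h, expNeg_iSup,
    ENNReal.mul_iInf fun h => absurd h hψ]

end Functional

/-! ### Conditional coverage probability -/

/-- This is where Rayleigh fading enters: an SIR condition becomes an exponential of the
interference. An infinite threshold gives zero on both sides. -/
theorem expMeasure_one_lt (w : ℝ≥0∞) : expMeasure 1 {g | w < ENNReal.ofReal g} = expNeg w := by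
  have := isProbabilityMeasure_expMeasure one_pos
  induction w using ENNReal.recTopCoe with
  | top => simp
  | coe w =>
    have h1 : {g : ℝ | (w : ℝ≥0∞) < ENNReal.ofReal g} = (Iic (w : ℝ))ᶜ := by
      ext g
      simp [ENNReal.lt_ofReal_iff_toReal_lt]
    have h2 := cdf_expMeasure_eq one_pos (w : ℝ)
    rw [cdf_eq_real, if_pos w.coe_nonneg, one_mul] at h2
    have h4 : (w : ℝ≥0∞) = ENNReal.ofReal w := by simp
    rw [h1, ← ofReal_measureReal, probReal_compl_eq_one_sub measurableSet_Iic, h2,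
      h4, expNeg_ofReal w.coe_nonneg]
    congr 1
    simp

/-- The Laplace transform of the exponential distribution. -/
theorem lintegral_expNeg_expMeasure {s : ℝ} (hs : 0 ≤ s) :
    ∫⁻ g, expNeg (ENNReal.ofReal (s * g)) ∂(expMeasure 1) = ENNReal.ofReal (1 / (1 + s)) := by
  have h0 : (0 : ℝ) < 1 + s := by linarith
  have hm : Measurable fun g : ℝ => expNeg (ENNReal.ofReal (s * g)) :=
    measurable_expNeg.comp (by fun_prop)
  have hpdf : ∀ r, Measurable (exponentialPDF r) := fun r =>
    (measurable_exponentialPDFReal r).ennreal_ofReal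
  have h1 : expMeasure 1 = volume.withDensity (exponentialPDF 1) := rfl
  rw [h1, lintegral_withDensity_eq_lintegral_mul _ (hpdf 1) hm]
  -- Tilting the rate-one density by `exp (-s g)` gives `1 / (1 + s)` times the density of rate `1 +
  -- s`.
  have h2 : ∀ g, (exponentialPDF 1 * fun g => expNeg (ENNReal.ofReal (s * g))) g =
      ENNReal.ofReal (1 / (1 + s)) * exponentialPDF (1 + s) g := by
    intro g
    rw [Pi.mul_apply, exponentialPDF_eq, exponentialPDF_eq]
    split_ifs with hg
    · rw [expNeg_ofReal (mul_nonneg hs hg), ← ENNReal.ofReal_mul (by positivity),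
        ← ENNReal.ofReal_mul (by positivity), ← mul_assoc, mul_assoc, ← Real.exp_add]
      congr 1
      rw [one_div_mul_cancel h0.ne']
      congr 2
      ring
    · simp
  rw [lintegral_congr h2, lintegral_const_mul _ (hpdf _), lintegral_exponentialPDF_eq_one h0,
    mul_one]

section Coverage

variable {Ω : Type*} [MeasurableSpace Ω] {μ : Measure Ω} [IsProbabilityMeasure μ]

theorem measurableSet_and_lt : MeasurableSet {z : (Prop × ℝ) × ℝ≥0∞ |
    z.1.1 ∧ z.2 < ENNReal.ofReal z.1.2} := by
  have h1 : MeasurableSet {z : (Prop × ℝ) × ℝ≥0∞ | z.1.1} :=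
    measurableSet_setOfPred.2 (measurable_fst.comp measurable_fst)
  exact h1.inter (measurableSet_lt measurable_snd
    (ENNReal.measurable_ofReal.comp (measurable_snd.comp measurable_fst)))

/-- Fubini: given `W = w`, the event has probability `μ T` times the exponential tail at `w`. -/
theorem measure_and_lt_of_indepFun {T : Ω → Prop} {g : Ω → ℝ} {W : Ω → ℝ≥0∞}
    (hT : Measurable T) (hg : Measurable g) (hW : Measurable W) (hTg : IndepFun T g μ)
    (hind : IndepFun (fun ω => (T ω, g ω)) W μ) (hlaw : μ.map g = expMeasure 1) :
    μ {ω | T ω ∧ W ω < ENNReal.ofReal (g ω)} = μ {ω | T ω} * ∫⁻ ω, expNeg (W ω) ∂μ := by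
  have h1 := (indepFun_iff_map_prod_eq_prod_map_map (hT.prodMk hg).aemeasurable
    hW.aemeasurable).1 hind
  have h2 : μ {ω | T ω ∧ W ω < ENNReal.ofReal (g ω)} =
      (μ.map fun ω => ((T ω, g ω), W ω)) {z | z.1.1 ∧ z.2 < ENNReal.ofReal z.1.2} := by
    rw [Measure.map_apply ((hT.prodMk hg).prodMk hW) measurableSet_and_lt]
    rfl
  have : IsProbabilityMeasure (μ.map fun ω => (T ω, g ω)) :=
    Measure.isProbabilityMeasure_map (hT.prodMk hg).aemeasurable
  have : IsProbabilityMeasure (μ.map W) := Measure.isProbabilityMeasure_map hW.aemeasurable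
  rw [h2, h1, Measure.prod_apply_symm measurableSet_and_lt, ← lintegral_const_mul _
    (show Measurable fun ω => expNeg (W ω) from measurable_expNeg.comp hW),
    lintegral_map (measurable_measure_prodMk_right measurableSet_and_lt) hW]
  refine lintegral_congr fun ω => ?_
  rw [Measure.map_apply (hT.prodMk hg) (measurable_prodMk_right measurableSet_and_lt)]
  have h3 := hTg.measure_inter_preimage_eq_mul {True} {x | W ω < ENNReal.ofReal x}
    (measurableSet_singleton _) (measurableSet_lt measurable_const ENNReal.measurable_ofReal)
  rw [← Measure.map_apply hg (measurableSet_lt measurable_const ENNReal.measurable_ofReal),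
    hlaw, expMeasure_one_lt] at h3
  convert h3 using 2
  · ext ω'; simp
  · congr 1; ext ω'; simp

variable {T : ℕ → Ω → Prop} {g : ℕ → Ω → ℝ}

-- The condition that no nearer station transmits is absorbed into the interference: a near station
-- with `T n` is given weight `∞`, which makes the inequality fail. The total weight `W` is then a
-- sum of independent terms, independent of station `b`, and `exp (-W)` factorizes. A factor has
-- mean `1 / (1 + s n)`, multiplied by `1 - a` if the station is near.
open Classical in
theorem measure_forall_and_tsum_lt (hT : ∀ n, Measurable (T n)) (hg : ∀ n, Measurable (g n))
    (hind : iIndepFun (fun n ω => (T n ω, g n ω)) μ) (hTg : ∀ n, IndepFun (T n) (g n) μ)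
    (hlaw : ∀ n, μ.map (g n) = expMeasure 1) {a : ℝ} (ha : 0 ≤ a)
    (hTa : ∀ n, μ {ω | T n ω} = ENNReal.ofReal a) (b : ℕ) (near : ℕ → Prop) (s : ℕ → ℝ)
    (hs : ∀ n, 0 ≤ s n) :
    μ {ω | T b ω ∧ (∀ n, n ≠ b → near n → ¬ T n ω) ∧
        ∑' n, (if n = b then 0 else ENNReal.ofReal (s n * g n ω)) < ENNReal.ofReal (g b ω)} =
      ENNReal.ofReal a * infProd fun n => if n = b then 1 else
        ENNReal.ofReal ((if near n then 1 - a else 1) / (1 + s n)) := by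
  let w : ℕ → Prop × ℝ → ℝ≥0∞ := fun n z =>
    if n = b then 0 else if near n ∧ z.1 then ∞ else ENNReal.ofReal (s n * z.2)
  have hw : ∀ n, Measurable (w n) := by
    intro n
    refine Measurable.ite (MeasurableSet.const _) measurable_const (Measurable.ite ?_
      measurable_const (by fun_prop))
    exact (MeasurableSet.const _).inter (measurableSet_setOfPred.2 measurable_fst)
  have hTgm : ∀ n, Measurable fun ω => (T n ω, g n ω) := fun n => (hT n).prodMk (hg n)
  let W : Ω → ℝ≥0∞ := fun ω => ∑' n, w n (T n ω, g n ω)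
  have hW : Measurable W := Measurable.tsum fun n => (hw n).comp (hTgm n)
  -- The term `n = b` of `W` is constant, so `W` is measurable with respect to the marks of the
  -- other stations.
  have hindW : IndepFun (fun ω => (T b ω, g b ω)) W μ := by
    rw [IndepFun_iff_Indep]
    rw [iIndepFun_iff_iIndep] at hind
    have h1 := indep_iSup_of_disjoint (fun n => (hTgm n).comap_le) hind
      (S := {b}) (T := {b}ᶜ) disjoint_compl_right
    refine indep_of_indep_of_le h1 (le_iSup₂_of_le b rfl le_rfl) ?_
    refine Measurable.comap_le ?_
    refine @Measurable.tsum Ω _ _ (⨆ n ∈ ({b} : Set ℕ)ᶜ, MeasurableSpace.comap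
      (fun ω => (T n ω, g n ω)) inferInstance) _ _ _ _ _ _ _ _ _ _ _ _ fun n => ?_
    by_cases hn : n = b
    · simp only [w, if_pos hn]
      exact measurable_const
    · exact (hw n).comp (Measurable.mono (comap_measurable _)
        (le_iSup₂_of_le (f := fun n (_ : n ∈ ({b} : Set ℕ)ᶜ) => MeasurableSpace.comap
          (fun ω => (T n ω, g n ω)) inferInstance) n hn le_rfl) le_rfl)
  have h1 : {ω | T b ω ∧ (∀ n, n ≠ b → near n → ¬ T n ω) ∧
      ∑' n, (if n = b then 0 else ENNReal.ofReal (s n * g n ω)) < ENNReal.ofReal (g b ω)} =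
      {ω | T b ω ∧ W ω < ENNReal.ofReal (g b ω)} := by
    ext ω
    simp only [Set.mem_ofPred_eq, and_congr_right_iff]
    intro _
    by_cases hall : ∀ n, n ≠ b → near n → ¬ T n ω
    · have : W ω = ∑' n, (if n = b then 0 else ENNReal.ofReal (s n * g n ω)) := by
        refine tsum_congr fun n => ?_
        by_cases hn : n = b
        · simp [w, hn]
        · simp only [w, if_neg hn]
          rw [if_neg fun h => hall n hn h.1 h.2]
      rw [this, and_iff_right hall]
    · have : W ω = ∞ := by
        push Not at hall
        obtain ⟨n, hn, hnear, hTn⟩ := hall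
        refine ENNReal.tsum_eq_top_of_eq_top ⟨n, ?_⟩
        simp [w, hn, hnear, hTn]
      simp only [this, not_top_lt, iff_false, not_and]
      exact fun h => absurd h hall
  rw [h1, measure_and_lt_of_indepFun (hT b) (hg b) hW (hTg b) hindW (hlaw b), hTa b]
  congr 1
  have hmY : ∀ n, Measurable fun ω => expNeg (w n (T n ω, g n ω)) := fun n =>
    measurable_expNeg.comp ((hw n).comp (hTgm n))
  simp only [W, expNeg_tsum]
  rw [lintegral_infProd (Y := fun n ω => expNeg (w n (T n ω, g n ω)))
    (hind.comp (fun n z => expNeg (w n z)) fun n => measurable_expNeg.comp (hw n)) hmY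
    fun n ω => expNeg_le_one _]
  congr 1
  funext n
  by_cases hn : n = b
  · simp [w, hn]
  rw [if_neg hn]
  have hL : ∫⁻ ω, expNeg (ENNReal.ofReal (s n * g n ω)) ∂μ = ENNReal.ofReal (1 / (1 + s n)) := by
    rw [← lintegral_expNeg_expMeasure (hs n), ← hlaw n, lintegral_map ?_ (hg n)]
    exact measurable_expNeg.comp (by fun_prop)
  by_cases hnear : near n
  · have h2 : ∀ ω, expNeg (w n (T n ω, g n ω)) =
        (if T n ω then 0 else 1) * expNeg (ENNReal.ofReal (s n * g n ω)) := by
      intro ω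
      by_cases hTn : T n ω <;> simp [w, hn, hnear, hTn]
    have h3 : Measurable fun t : Prop => if t then (0 : ℝ≥0∞) else 1 := measurable_of_countable _
    have h4 : ∫⁻ ω, (if T n ω then (0 : ℝ≥0∞) else 1) ∂μ = ENNReal.ofReal (1 - a) := by
      have h5 : ∀ ω, (if T n ω then (0 : ℝ≥0∞) else 1) = {ω | T n ω}ᶜ.indicator 1 ω := by
        intro ω
        by_cases hTn : T n ω <;> simp [hTn]
      rw [lintegral_congr h5, lintegral_indicator_one (measurableSet_setOfPred.2 (hT n)).compl,
        prob_compl_eq_one_sub (measurableSet_setOfPred.2 (hT n)), hTa n]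
      rw [ENNReal.ofReal_sub _ ha, ENNReal.ofReal_one]
    have h6 : Measurable fun x => expNeg (ENNReal.ofReal (s n * x)) :=
      measurable_expNeg.comp (by fun_prop)
    rw [lintegral_congr h2, lintegral_mul_eq_lintegral_mul_lintegral_of_indepFun''
      (f := fun ω => if T n ω then (0 : ℝ≥0∞) else 1)
      (g := fun ω => expNeg (ENNReal.ofReal (s n * g n ω)))
      (h3.comp (hT n)).aemeasurable (h6.comp (hg n)).aemeasurable
      ((hTg n).comp h3 h6)]
    rw [hL, h4, if_pos hnear, ← ENNReal.ofReal_mul' (by have := hs n; positivity)]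
    congr 1
    ring
  · have h2 : ∀ ω, expNeg (w n (T n ω, g n ω)) = expNeg (ENNReal.ofReal (s n * g n ω)) := by
      intro ω
      simp [w, hn, hnear]
    rw [lintegral_congr h2, hL, if_neg hnear]

end Coverage

/-! ### The hit event given the locations -/

/-- Base station `b` serves the user and the signal-to-interference ratio exceeds `γ`. -/
def IsHitBy {F : ℕ} (P α γ : ℝ) (x : ℕ → Plane) (cache : ℕ → Set (Fin F)) (active : ℕ → Bool)
    (g : ℕ → ℝ) (i : Fin F) (b : ℕ) : Prop :=
  IsServing P α x cache active i b ∧ ENNReal.ofReal γ < SIR P α x cache active g i b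

/-- The expected factor by which a base station at distance `y` diminishes the hit probability
of a user served from distance `r`, when base stations transmit the file with probability `a`. -/
def hitFactor (a α γ r y : ℝ) : ℝ := (if y < r then 1 - a else 1) / (1 + γ * r ^ α * y ^ (-α))

section Deterministic

variable {F : ℕ} {P α γ : ℝ} {x : ℕ → Plane} {cache : ℕ → Set (Fin F)} {active : ℕ → Bool}
  {g : ℕ → ℝ} {i : Fin F} {b : ℕ}

/-- Path loss strictly decreases with positive distance. A station at the origin must be excluded,
since `0 ^ (-α) = 0` in Lean. -/
theorem isServing_iff (hP : 0 < P) (hα : 0 < α) (hx : ∀ n, x n ≠ 0) :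
    IsServing P α x cache active i b ↔ (i ∈ cache b ∧ active b = true) ∧
      ∀ n, n ≠ b → ‖x n‖ < ‖x b‖ → ¬ (i ∈ cache n ∧ active n = true) := by
  refine and_congr Iff.rfl ⟨fun h n _ hlt hn => ?_, fun h n hn => ?_⟩
  · have h1 := (mul_le_mul_iff_right₀ hP).1 (h n hn)
    rw [Real.rpow_le_rpow_iff_of_neg (norm_pos_iff.2 (hx _)) (norm_pos_iff.2 (hx _))
      (by linarith)] at h1
    linarith
  · rw [mul_le_mul_iff_right₀ hP, Real.rpow_le_rpow_iff_of_neg (norm_pos_iff.2 (hx _))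
      (norm_pos_iff.2 (hx _)) (by linarith)]
    by_contra! hlt
    exact h n (fun hnb => by simp [hnb] at hlt) hlt hn

/-- The non-caching stations, the jammers and the transmitters partition the indices. -/
theorem interference_eq (hb : b ∈ transmitters cache active i) :
    interference P α x cache active g i b =
      ∑' n, if n = b then 0 else receivedPower P α (g n) (x n) := by
  classical
  unfold interference
  rw [tsum_subtype (nonCaching cache i ∪ jammers cache active i)
      fun n => receivedPower P α (g n) (x n),
    tsum_subtype (transmitters cache active i \ {b}) fun n => receivedPower P α (g n) (x n),
    ← ENNReal.tsum_add]
  refine tsum_congr fun n => ?_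
  have hb' : i ∈ cache b ∧ active b = true := hb
  simp only [Set.indicator_apply, Set.mem_union, nonCaching, jammers, transmitters,
    Set.mem_ofPred_eq, Set.mem_sdiff, Set.mem_singleton_iff]
  by_cases hn : n = b
  · subst hn
    simp [hb']
  · by_cases h1 : i ∈ cache n <;> by_cases h2 : active n = true <;> simp [hn, h1, h2]

/-- The SIR inequality is multiplied by the interference and divided by the mean received power `P
‖x b‖ ^ (-α)` of the server. -/
theorem isHitBy_iff (hP : 0 < P) (hα : 0 < α) (hγ : 0 < γ) (hx : ∀ n, x n ≠ 0) :
    IsHitBy P α γ x cache active g i b ↔ (i ∈ cache b ∧ active b = true) ∧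
      (∀ n, n ≠ b → ‖x n‖ < ‖x b‖ → ¬ (i ∈ cache n ∧ active n = true)) ∧
      ∑' n, (if n = b then 0 else
        ENNReal.ofReal (γ * ‖x b‖ ^ α * ‖x n‖ ^ (-α) * g n)) < ENNReal.ofReal (g b) := by
  unfold IsHitBy
  rw [isServing_iff hP hα hx, and_assoc]
  refine and_congr_right fun hb => and_congr_right fun _ => ?_
  have hr : 0 < ‖x b‖ := norm_pos_iff.2 (hx b)
  set c : ℝ := P * ‖x b‖ ^ (-α) with hc
  have hc0 : 0 < c := by positivity
  have h1 : receivedPower P α (g b) (x b) = ENNReal.ofReal c * ENNReal.ofReal (g b) := by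
    rw [receivedPower, ← ENNReal.ofReal_mul hc0.le, hc]
    congr 1
    ring
  have h2 : ENNReal.ofReal γ * interference P α x cache active g i b =
      ENNReal.ofReal c * ∑' n, (if n = b then 0 else
        ENNReal.ofReal (γ * ‖x b‖ ^ α * ‖x n‖ ^ (-α) * g n)) := by
    rw [interference_eq hb, ← ENNReal.tsum_mul_left, ← ENNReal.tsum_mul_left]
    refine tsum_congr fun n => ?_
    split_ifs
    · simp
    · rw [receivedPower, ← ENNReal.ofReal_mul hγ.le, ← ENNReal.ofReal_mul hc0.le, hc]
      congr 1
      have : ‖x b‖ ^ (-α) * ‖x b‖ ^ α = 1 := by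
        rw [← Real.rpow_add hr]; simp
      linear_combination -(P * γ * ‖x n‖ ^ (-α) * g n) * this
  have hγ0 : ENNReal.ofReal γ ≠ 0 := by simpa using hγ
  have h3 : ENNReal.ofReal γ < SIR P α x cache active g i b ↔
      ENNReal.ofReal γ * interference P α x cache active g i b <
        receivedPower P α (g b) (x b) := by
    unfold SIR
    -- Both sides fail when the interference is infinite or the signal vanishes; otherwise division
    -- in `ℝ≥0∞` is harmless, even for zero interference.
    by_cases hI : interference P α x cache active g i b = ∞
    · rw [hI, ENNReal.div_top, ENNReal.mul_top hγ0]
      simp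
    by_cases hS : receivedPower P α (g b) (x b) = 0
    · simp [hS]
    · exact ENNReal.lt_div_iff_mul_lt (Or.inr ENNReal.ofReal_ne_top) (Or.inl hI)
  rw [h3, h1, h2, ENNReal.mul_lt_mul_iff_right (by simpa using hc0) ENNReal.ofReal_ne_top]

end Deterministic

section Network

variable {Ω : Type*} [MeasurableSpace Ω] {μ : Measure Ω} [IsProbabilityMeasure μ] {F : ℕ}
  {lam lamE D P α γ : ℝ} {p : Fin F → ℝ} {X : ℕ → Ω → Plane} {Φe : Ω → Set Plane}
  {cache : ℕ → Ω → Set (Fin F)} {active : ℕ → Ω → Bool} {h : ℕ → Ω → ℝ}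

/-- Associativity of the product of the three laws. -/
theorem IndepFun.prodMk_left {A B C : Type*} [MeasurableSpace A] [MeasurableSpace B]
    [MeasurableSpace C] {f : Ω → A} {g : Ω → B} {k : Ω → C} (hf : Measurable f)
    (hg : Measurable g) (hk : Measurable k) (h1 : IndepFun f (fun ω => (g ω, k ω)) μ)
    (h2 : IndepFun g k μ) : IndepFun (fun ω => (f ω, g ω)) k μ := by
  have h3 : IndepFun f g μ := h1.comp (φ := id) (ψ := Prod.fst) measurable_id measurable_fst
  have := Measure.isProbabilityMeasure_map (μ := μ) hf.aemeasurable
  have := Measure.isProbabilityMeasure_map (μ := μ) hg.aemeasurable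
  have := Measure.isProbabilityMeasure_map (μ := μ) hk.aemeasurable
  rw [indepFun_iff_map_prod_eq_prod_map_map (by fun_prop) (by fun_prop)] at h1 h2 h3 ⊢
  rw [h3, ← MeasurableEquiv.prodAssoc.map_measurableEquiv_injective.eq_iff,
    Measure.prodAssoc_prod, ← h2, ← h1, Measure.map_map (by fun_prop) (by fun_prop)]
  rfl

/-- Void probability of the eavesdropper process on a disk of area `π D²`. -/
theorem IsNetwork.active_prob_eq (hnet : IsNetwork μ lam lamE D p X Φe cache active h)
    (hlamE : 0 ≤ lamE) (hD : 0 ≤ D) (n : ℕ) :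
    μ {ω | active n ω = true} = ENNReal.ofReal (Real.exp (-(Real.pi * lamE * D ^ 2))) := by
  have hfin : (ENNReal.ofReal lamE • (volume : Measure Plane)) (Metric.closedBall 0 D) ≠ ∞ := by
    rw [Measure.smul_apply, smul_eq_mul]
    exact ENNReal.mul_ne_top ENNReal.ofReal_ne_top measure_closedBall_lt_top.ne
  have h1 := hnet.eve_ppp.count_law (Metric.closedBall 0 D) measurableSet_closedBall hfin 0
  have h2 := hnet.active_prob n
  simp only [Nat.cast_zero, Set.encard_eq_zero] at h1
  rw [measureReal_def, measureReal_def, ENNReal.toReal_eq_toReal_iff' (measure_ne_top _ _)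
    (measure_ne_top _ _)] at h2
  rw [h2, h1, poissonMeasure_singleton]
  congr 1
  rw [Measure.smul_apply, smul_eq_mul, EuclideanSpace.volume_closedBall_fin_two]
  simp only [pow_zero, mul_one, Nat.factorial_zero, Nat.cast_one, div_one,
    ENNReal.coe_toNNReal_eq_toReal, ENNReal.toReal_mul, ENNReal.toReal_pow,
    ENNReal.toReal_ofReal hlamE, ENNReal.toReal_ofReal hD,
    ENNReal.toReal_ofReal Real.pi_nonneg]
  congr 1
  ring

theorem IsNetwork.transmit_prob (hnet : IsNetwork μ lam lamE D p X Φe cache active h)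
    (hlamE : 0 ≤ lamE) (hD : 0 ≤ D) (i : Fin F) (n : ℕ) :
    μ {ω | i ∈ cache n ω ∧ active n ω = true} =
      ENNReal.ofReal (p i * Real.exp (-(Real.pi * lamE * D ^ 2))) := by
  have h1 : IndepFun (cache n) (active n) μ :=
    (hnet.indep_cache n).comp (φ := id) (ψ := Prod.fst) measurable_id measurable_fst
  have h2 := h1.measure_inter_preimage_eq_mul {c | i ∈ c} {true}
    (measurableSet_setOfPred.2 (measurable_set_mem i)) (measurableSet_singleton _)
  have h3 : μ (cache n ⁻¹' {c | i ∈ c}) = ENNReal.ofReal (p i) := by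
    rw [← hnet.cache_prob n i, ofReal_measureReal]
    rfl
  have h4 : 0 ≤ p i := by
    rw [← hnet.cache_prob n i]; exact measureReal_nonneg
  rw [ENNReal.ofReal_mul h4, ← h3, ← hnet.active_prob_eq hlamE hD n]
  exact h2

theorem IsNetwork.measure_isHitBy (hnet : IsNetwork μ lam lamE D p X Φe cache active h)
    (hlamE : 0 ≤ lamE) (hD : 0 ≤ D) (hP : 0 < P) (hα : 0 < α) (hγ : 0 < γ) (i : Fin F)
    {x : ℕ → Plane} (hx : ∀ n, x n ≠ 0) (b : ℕ) {a : ℝ}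
    (ha : a = p i * Real.exp (-(Real.pi * lamE * D ^ 2))) :
    μ {ω | IsHitBy P α γ x (fun n => cache n ω) (fun n => active n ω) (fun n => h n ω) i b} =
      ENNReal.ofReal a * infProd fun n => if n = b then 1 else
        ENNReal.ofReal (hitFactor a α γ ‖x b‖ ‖x n‖) := by
  simp_rw [isHitBy_iff hP hα hγ hx]
  have hmT : Measurable fun z : Set (Fin F) × Bool × ℝ => (i ∈ z.1 ∧ z.2.1 = true) := by
    refine measurableSet_setOfPred.1 (MeasurableSet.inter
      (measurableSet_setOfPred.2 ((measurable_set_mem i).comp measurable_fst)) ?_)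
    exact (measurable_fst.comp measurable_snd) (measurableSet_singleton true)
  have hT : ∀ n, Measurable fun ω => (i ∈ cache n ω ∧ active n ω = true) := fun n =>
    hmT.comp ((hnet.measurable_cache n).prodMk
      ((hnet.measurable_active n).prodMk (hnet.measurable_fading n)))
  have hind : iIndepFun (fun n ω => ((i ∈ cache n ω ∧ active n ω = true), h n ω)) μ :=
    hnet.indep_marks.comp (fun _ z => ((i ∈ z.1 ∧ z.2.1 = true), z.2.2)) fun _ =>
      hmT.prodMk (measurable_snd.comp measurable_snd)
  have hTh : ∀ n, IndepFun (fun ω => (i ∈ cache n ω ∧ active n ω = true)) (h n) μ := by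
    intro n
    have h1 : IndepFun (fun ω => (cache n ω, active n ω)) (h n) μ :=
      IndepFun.prodMk_left (hnet.measurable_cache n) (hnet.measurable_active n)
        (hnet.measurable_fading n) (hnet.indep_cache n) (hnet.indep_active n)
    refine h1.comp (φ := fun z => (i ∈ z.1 ∧ z.2 = true)) (ψ := id) ?_ measurable_id
    exact hmT.comp (measurable_fst.prodMk (measurable_snd.prodMk (measurable_const (a := (0 : ℝ)))))
  have ha0 : 0 ≤ a := by
    rw [ha, ← hnet.cache_prob 0 i]
    have : 0 ≤ μ.real {ω | i ∈ cache 0 ω} := measureReal_nonneg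
    positivity
  have key := measure_forall_and_tsum_lt hT hnet.measurable_fading hind hTh hnet.fading_law ha0
    (fun n => (hnet.transmit_prob hlamE hD i n).trans (by rw [ha])) b (fun n => ‖x n‖ < ‖x b‖)
    (fun n => γ * ‖x b‖ ^ α * ‖x n‖ ^ (-α)) (fun n => by positivity)
  simp only [hitFactor]
  convert key using 3

/-- Joint measurability in locations and marks is what permits freezing the locations by Fubini. -/
theorem measurableSet_isHitBy (P α γ : ℝ) (i : Fin F) (b : ℕ) :
    MeasurableSet {z : (ℕ → Plane) × (ℕ → Set (Fin F) × Bool × ℝ) |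
      IsHitBy P α γ z.1 (fun n => (z.2 n).1) (fun n => (z.2 n).2.1) (fun n => (z.2 n).2.2) i b} := by
  classical
  have hcm : ∀ n, MeasurableSet {z : (ℕ → Plane) × (ℕ → Set (Fin F) × Bool × ℝ) |
      i ∈ (z.2 n).1} := fun n =>
    measurableSet_setOfPred.2 ((measurable_set_mem i).comp (by fun_prop))
  have ham : ∀ n (c : Bool), MeasurableSet {z : (ℕ → Plane) × (ℕ → Set (Fin F) × Bool × ℝ) |
      (z.2 n).2.1 = c} := fun n c =>
    (show Measurable fun z : (ℕ → Plane) × (ℕ → Set (Fin F) × Bool × ℝ) => (z.2 n).2.1 by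
      fun_prop) (measurableSet_singleton c)
  have hTm : ∀ n, MeasurableSet {z : (ℕ → Plane) × (ℕ → Set (Fin F) × Bool × ℝ) |
      n ∈ transmitters (fun n => (z.2 n).1) (fun n => (z.2 n).2.1) i} := fun n =>
    (hcm n).inter (ham n true)
  have hNm : ∀ n, MeasurableSet {z : (ℕ → Plane) × (ℕ → Set (Fin F) × Bool × ℝ) |
      n ∈ nonCaching (fun n => (z.2 n).1) i ∪
        jammers (fun n => (z.2 n).1) (fun n => (z.2 n).2.1) i} := fun n =>
    (hcm n).compl.union ((hcm n).inter (ham n false))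
  have hpow : ∀ n, Measurable fun z : (ℕ → Plane) × (ℕ → Set (Fin F) × Bool × ℝ) =>
      P * ‖z.1 n‖ ^ (-α) := fun n => by fun_prop
  have hrp : ∀ n, Measurable fun z : (ℕ → Plane) × (ℕ → Set (Fin F) × Bool × ℝ) =>
      receivedPower P α (z.2 n).2.2 (z.1 n) := fun n => by
    unfold receivedPower
    fun_prop
  have hmax : MeasurableSet {z : (ℕ → Plane) × (ℕ → Set (Fin F) × Bool × ℝ) |
      ∀ n ∈ transmitters (fun n => (z.2 n).1) (fun n => (z.2 n).2.1) i,
        P * ‖z.1 n‖ ^ (-α) ≤ P * ‖z.1 b‖ ^ (-α)} := by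
    simp only [imp_iff_not_or, Set.ofPred_forall]
    exact MeasurableSet.iInter fun n =>
      (hTm n).compl.union (measurableSet_le (hpow n) (hpow b))
  have hint : Measurable fun z : (ℕ → Plane) × (ℕ → Set (Fin F) × Bool × ℝ) =>
      interference P α z.1 (fun n => (z.2 n).1) (fun n => (z.2 n).2.1)
        (fun n => (z.2 n).2.2) i b := by
    have heq : ∀ z : (ℕ → Plane) × (ℕ → Set (Fin F) × Bool × ℝ),
        interference P α z.1 (fun n => (z.2 n).1) (fun n => (z.2 n).2.1)
          (fun n => (z.2 n).2.2) i b =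
        (∑' n, if n ∈ nonCaching (fun n => (z.2 n).1) i ∪
          jammers (fun n => (z.2 n).1) (fun n => (z.2 n).2.1) i then
            receivedPower P α (z.2 n).2.2 (z.1 n) else 0) +
        ∑' n, if n ∈ transmitters (fun n => (z.2 n).1) (fun n => (z.2 n).2.1) i \ {b} then
            receivedPower P α (z.2 n).2.2 (z.1 n) else 0 := by
      intro z
      unfold interference
      rw [tsum_subtype _ fun n => receivedPower P α (z.2 n).2.2 (z.1 n),
        tsum_subtype _ fun n => receivedPower P α (z.2 n).2.2 (z.1 n)]
      simp only [Set.indicator_apply]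
    simp_rw [heq]
    exact (Measurable.tsum fun n => Measurable.ite (hNm n) (hrp n) measurable_const).add
      (Measurable.tsum fun n => Measurable.ite
        ((hTm n).inter (MeasurableSet.const (¬ n = b))) (hrp n) measurable_const)
  exact ((hTm b).inter hmax).inter
    (measurableSet_lt (measurable_const (a := ENNReal.ofReal γ)) ((hrp b).div hint))

end Network

/-! ### Integral representations of the special functions -/

theorem lintegral_rpow_mul_exp_neg {s c : ℝ} (hs : 0 < s) (hc : 0 < c) :
    ∫⁻ t in Ioi (0 : ℝ), ENNReal.ofReal (t ^ (s - 1) * Real.exp (-(c * t))) =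
      ENNReal.ofReal ((1 / c) ^ s * Real.Gamma s) := by
  have h1 := Real.integral_rpow_mul_exp_neg_mul_Ioi hs hc
  have h2 : 0 < (1 / c) ^ s * Real.Gamma s := by
    have := Real.Gamma_pos_of_pos hs
    positivity
  rw [← h1, ofReal_integral_eq_lintegral_ofReal]
  -- A non-integrable function would have Bochner integral zero, but the value is positive.
  · exact Integrable.of_integral_ne_zero (by rw [h1]; exact h2.ne')
  · filter_upwards [ae_restrict_mem measurableSet_Ioi] with t ht
    have : (0 : ℝ) < t := ht
    positivity

/-- Write `1 / (1 + γ x)` as `∫ exp (-(1 + γ x) t) dt` and apply Tonelli. The integral over `x`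
gives `Γ(b) (γ t) ^ (-b)`, and the one over `t` then gives `Γ(1 - b)`. -/
theorem lintegral_rpow_div_one_add {b γ : ℝ} (hb : 0 < b) (hb1 : b < 1) (hγ : 0 < γ) :
    ∫⁻ x in Ioi (0 : ℝ), ENNReal.ofReal (x ^ (b - 1) / (1 + γ * x)) =
      ENNReal.ofReal (γ ^ (-b) * ProbabilityTheory.beta b (1 - b)) := by
  have h1 : ∀ x ∈ Ioi (0 : ℝ), ENNReal.ofReal (x ^ (b - 1) / (1 + γ * x)) =
      ∫⁻ t in Ioi (0 : ℝ), ENNReal.ofReal (x ^ (b - 1) * Real.exp (-((1 + γ * x) * t))) := by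
    intro x hx
    have hx0 : (0 : ℝ) < x := hx
    have hc : 0 < 1 + γ * x := by positivity
    have h2 := lintegral_rpow_mul_exp_neg one_pos hc
    simp only [sub_self, Real.rpow_zero, one_mul, Real.rpow_one, Real.Gamma_one, mul_one] at h2
    have h3 : 0 ≤ x ^ (b - 1) := by positivity
    simp_rw [ENNReal.ofReal_mul h3]
    rw [lintegral_const_mul _ (by fun_prop), h2, ← ENNReal.ofReal_mul h3]
    congr 1
    ring
  rw [setLIntegral_congr_fun measurableSet_Ioi h1, lintegral_lintegral_swap (by fun_prop)]
  have h4 : ∀ t ∈ Ioi (0 : ℝ),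
      ∫⁻ x in Ioi (0 : ℝ), ENNReal.ofReal (x ^ (b - 1) * Real.exp (-((1 + γ * x) * t))) =
      ENNReal.ofReal (γ ^ (-b) * Real.Gamma b) *
        ENNReal.ofReal (t ^ ((1 - b) - 1) * Real.exp (-(1 * t))) := by
    intro t ht
    have ht0 : (0 : ℝ) < t := ht
    have h5 : ∀ x : ℝ, ENNReal.ofReal (x ^ (b - 1) * Real.exp (-((1 + γ * x) * t))) =
        ENNReal.ofReal (Real.exp (-t)) *
          ENNReal.ofReal (x ^ (b - 1) * Real.exp (-((γ * t) * x))) := by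
      intro x
      rw [← ENNReal.ofReal_mul (Real.exp_nonneg _), mul_left_comm, ← Real.exp_add]
      congr 3
      ring
    have h6 := Real.Gamma_pos_of_pos hb
    simp_rw [h5]
    rw [lintegral_const_mul _ (by fun_prop), lintegral_rpow_mul_exp_neg hb (by positivity),
      ← ENNReal.ofReal_mul (by positivity), ← ENNReal.ofReal_mul (by positivity)]
    congr 1
    rw [one_div, Real.inv_rpow (by positivity), ← Real.rpow_neg (by positivity),
      Real.mul_rpow hγ.le ht0.le, show (1 - b) - 1 = -b by ring, one_mul]
    ring
  have h7 := Real.Gamma_pos_of_pos hb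
  rw [setLIntegral_congr_fun measurableSet_Ioi h4, lintegral_const_mul _ (by fun_prop),
    lintegral_rpow_mul_exp_neg (by linarith) one_pos, ← ENNReal.ofReal_mul (by positivity)]
  congr 1
  simp [ProbabilityTheory.beta]
  ring

theorem integrableOn_rpow_div_one_add {b γ : ℝ} (hb : 0 < b) (hb1 : b < 1) (hγ : 0 < γ) :
    IntegrableOn (fun x : ℝ => x ^ (b - 1) / (1 + γ * x)) (Ioi 0) := by
  refine (lintegral_ofReal_ne_top_iff_integrable
    (Measurable.aestronglyMeasurable (by fun_prop)) ?_).1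
    (by rw [lintegral_rpow_div_one_add hb hb1 hγ]; exact ENNReal.ofReal_ne_top)
  filter_upwards [ae_restrict_mem measurableSet_Ioi] with x hx
  have : (0 : ℝ) < x := hx
  positivity

theorem integral_rpow_div_one_add {b γ : ℝ} (hb : 0 < b) (hb1 : b < 1) (hγ : 0 < γ) :
    ∫ x in Ioi (0 : ℝ), x ^ (b - 1) / (1 + γ * x) =
      γ ^ (-b) * ProbabilityTheory.beta b (1 - b) := by
  have hB : 0 < ProbabilityTheory.beta b (1 - b) := by
    have h1 := Real.Gamma_pos_of_pos hb
    have h2 := Real.Gamma_pos_of_pos (sub_pos.2 hb1)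
    simp [ProbabilityTheory.beta]
    positivity
  rw [integral_eq_lintegral_of_nonneg_ae _ (Measurable.aestronglyMeasurable (by fun_prop)),
    lintegral_rpow_div_one_add hb hb1 hγ,
    ENNReal.toReal_ofReal (by positivity)]
  filter_upwards [ae_restrict_mem measurableSet_Ioi] with x hx
  have : (0 : ℝ) < x := hx
  positivity

theorem kappa1_eq_integral {δ γ : ℝ} (hδ : 0 < δ) (hδ1 : δ < 1) (hγ : 0 < γ) :
    kappa1 δ γ = δ * γ * ∫ x in Ioi (0 : ℝ), x ^ (-δ) / (1 + γ * x) := by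
  have h := integral_rpow_div_one_add (b := 1 - δ) (by linarith) (by linarith) hγ
  rw [show 1 - δ - 1 = -δ by ring, show 1 - (1 - δ) = δ by ring] at h
  rw [h, kappa1, show γ ^ δ = γ * γ ^ (-(1 - δ)) by
    rw [← Real.rpow_one_add' hγ.le (by simpa using hδ.ne')]; congr 1; ring]
  ring

theorem kappa1_pos {δ γ : ℝ} (hδ : 0 < δ) (hδ1 : δ < 1) (hγ : 0 < γ) : 0 < kappa1 δ γ := by
  have h1 := Real.Gamma_pos_of_pos hδ
  have h2 := Real.Gamma_pos_of_pos (sub_pos.2 hδ1)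
  simp [kappa1, ProbabilityTheory.beta]
  positivity

/-! ### Euler's integral for the hypergeometric function -/

theorem integrableOn_rpow_Ioc {b : ℝ} (hb : 0 < b) :
    IntegrableOn (fun w : ℝ => w ^ (b - 1)) (Ioc 0 1) := by
  rw [integrableOn_Ioc_iff_integrableOn_Ioo, intervalIntegral.integrableOn_Ioo_rpow_iff one_pos]
  linarith

theorem integral_rpow_Ioc {b : ℝ} (hb : 0 < b) : ∫ w in Ioc (0 : ℝ) 1, w ^ (b - 1) = 1 / b := by
  rw [← intervalIntegral.integral_of_le zero_le_one, integral_rpow (Or.inl (by linarith))]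
  simp [hb.ne']

/-- The real part `1 - w Re z` is affine in `w`, hence at least the smaller of its values at `w = 0`
and `w = 1`. -/
theorem min_le_re_one_sub_mul {z : ℂ} {w : ℝ} (hw0 : 0 < w) (hw1 : w ≤ 1) :
    min 1 (1 - z.re) ≤ ‖1 - z * w‖ := by
  have h1 : (1 - z * w).re ≤ ‖1 - z * w‖ := Complex.re_le_norm _
  have h2 : (1 - z * w).re = 1 - z.re * w := by simp
  rw [h2] at h1
  refine le_trans ?_ h1
  rcases le_total 0 z.re with h | h
  · exact (min_le_right _ _).trans (by nlinarith)
  · exact (min_le_left _ _).trans (by nlinarith)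

/-- Euler's integral for `₂F₁(1, b; b + 1; ·)`, up to the factor `b`, is differentiable on the
half-plane to the left of one. -/
theorem differentiableOn_eulerIntegral {b : ℝ} (hb : 0 < b) :
    DifferentiableOn ℂ (fun z : ℂ => ∫ w in Ioc (0 : ℝ) 1, ((w ^ (b - 1) : ℝ) : ℂ) / (1 - z * w))
      {z | z.re < 1} := by
  intro z₀ hz₀
  have hz₀' : z₀.re < 1 := hz₀
  -- On the half-plane `Re z < c`, a neighbourhood of `z₀`, the denominators stay at least `m` in
  -- norm. This gives the dominating function `w ^ (b - 1) / m ^ 2` for the derivative.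
  obtain ⟨c, hc1, hc2⟩ := exists_between hz₀'
  set m := min 1 (1 - c) with hm
  have hm0 : 0 < m := lt_min one_pos (by linarith)
  have hbound : ∀ z : ℂ, z.re < c → ∀ w : ℝ, 0 < w → w ≤ 1 → m ≤ ‖1 - z * w‖ := by
    intro z hz w hw0 hw1
    exact (min_le_min_left _ (by linarith)).trans (min_le_re_one_sub_mul hw0 hw1)
  have hopen : {z : ℂ | z.re < c} ∈ 𝓝 z₀ :=
    (isOpen_lt Complex.continuous_re continuous_const).mem_nhds hc1
  have hmeas : ∀ z : ℂ, AEStronglyMeasurable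
      (fun w : ℝ => ((w ^ (b - 1) : ℝ) : ℂ) / (1 - z * w)) (volume.restrict (Ioc 0 1)) :=
    fun z => by
      refine Measurable.aestronglyMeasurable ?_
      fun_prop
  have hint := integrableOn_rpow_Ioc hb
  have key := hasDerivAt_integral_of_dominated_loc_of_deriv_le
    (μ := volume.restrict (Ioc (0 : ℝ) 1)) (𝕜 := ℂ)
    (F := fun z (w : ℝ) => ((w ^ (b - 1) : ℝ) : ℂ) / (1 - z * w))
    (F' := fun z (w : ℝ) => ((w ^ (b - 1) : ℝ) : ℂ) * w / (1 - z * w) ^ 2)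
    (bound := fun w => w ^ (b - 1) * (1 / m ^ 2)) (x₀ := z₀) hopen
    (Eventually.of_forall hmeas) ?_ ?_ ?_ (hint.mul_const _) ?_
  · exact key.2.differentiableAt.differentiableWithinAt
  · refine (hint.mul_const (1 / m)).mono' (hmeas z₀) ?_
    filter_upwards [ae_restrict_mem measurableSet_Ioc] with w hw
    have h0 : 0 ≤ w ^ (b - 1) := Real.rpow_nonneg hw.1.le _
    rw [norm_div, Complex.norm_real, Real.norm_of_nonneg h0, div_eq_mul_one_div]
    gcongr
    exact hbound z₀ hc1 w hw.1 hw.2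
  · refine Measurable.aestronglyMeasurable ?_
    fun_prop
  · filter_upwards [ae_restrict_mem measurableSet_Ioc] with w hw z hz
    have h0 : 0 ≤ w ^ (b - 1) := Real.rpow_nonneg hw.1.le _
    rw [norm_div, norm_mul, norm_pow, Complex.norm_real, Real.norm_of_nonneg h0,
      Complex.norm_real, Real.norm_of_nonneg hw.1.le, div_eq_mul_one_div]
    have := hbound z hz w hw.1 hw.2
    gcongr
    exact mul_le_of_le_one_right h0 hw.2
  · filter_upwards [ae_restrict_mem measurableSet_Ioc] with w hw z hz
    have h0 : (1 : ℂ) - z * w ≠ 0 := by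
      rw [← norm_pos_iff]
      exact hm0.trans_le (hbound z hz w hw.1 hw.2)
    have h1 : HasDerivAt (fun z : ℂ => 1 - z * w) (-w) z := by
      simpa using ((hasDerivAt_id z).mul_const (w : ℂ)).const_sub 1
    have h2 := (hasDerivAt_const z ((w ^ (b - 1) : ℝ) : ℂ)).div h1 h0
    refine h2.congr_deriv ?_
    ring

/-- Both `(b)ₙ (b + n)` and `b (b + 1)ₙ` equal `(b)ₙ₊₁`. -/
theorem ascPochhammer_eval_div {b : ℝ} (hb : 0 < b) (n : ℕ) :
    (ascPochhammer ℝ n).eval b * ((ascPochhammer ℝ n).eval (b + 1))⁻¹ = b / (b + n) := by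
  have h1 : (ascPochhammer ℝ n).eval b * (b + n) = b * (ascPochhammer ℝ n).eval (b + 1) := by
    rw [← ascPochhammer_succ_eval, ascPochhammer_succ_left]
    simp
  have h2 : 0 < (ascPochhammer ℝ n).eval (b + 1) := ascPochhammer_pos n _ (by linarith)
  field_simp
  linarith

/-- Expand `1 / (1 - x w)` geometrically and integrate term by term; `b ∫ w ^ (b + n - 1) = b / (b +
n)` is the hypergeometric coefficient, since `(1)ₙ` cancels `n!`. -/
theorem ordinaryHypergeometric_one_eq_integral {b x : ℝ} (hb : 0 < b) (hx : x ∈ Ioo (-1 : ℝ) 1) :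
    ordinaryHypergeometric 1 b (b + 1) x =
      b * ∫ w in Ioc (0 : ℝ) 1, w ^ (b - 1) / (1 - x * w) := by
  have habs : |x| < 1 := abs_lt.2 hx
  have hF : ∀ (y : ℝ) (n : ℕ), ∀ w ∈ Ioc (0 : ℝ) 1,
      w ^ (b - 1) * (y * w) ^ n = y ^ n * w ^ (b + n - 1) := by
    intro y n w hw
    rw [mul_pow, show b + n - 1 = (b - 1) + n by ring, Real.rpow_add hw.1, Real.rpow_natCast]
    ring
  have hbn : ∀ n : ℕ, 0 < b + n := fun n => by positivity
  have hint : ∀ (y : ℝ) (n : ℕ), IntegrableOn (fun w : ℝ => w ^ (b - 1) * (y * w) ^ n) (Ioc 0 1) :=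
    fun y n => (integrableOn_congr_fun (hF y n) measurableSet_Ioc).2
      ((integrableOn_rpow_Ioc (hbn n)).const_mul _)
  have hval : ∀ (y : ℝ) (n : ℕ), ∫ w in Ioc (0 : ℝ) 1, w ^ (b - 1) * (y * w) ^ n =
      y ^ n * (1 / (b + n)) := fun y n => by
    rw [setIntegral_congr_fun measurableSet_Ioc (hF y n), integral_const_mul,
      integral_rpow_Ioc (hbn n)]
  have hnorm : ∀ n : ℕ, ∫ w in Ioc (0 : ℝ) 1, ‖w ^ (b - 1) * (x * w) ^ n‖ =
      |x| ^ n * (1 / (b + n)) := fun n => by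
    rw [← hval]
    refine setIntegral_congr_fun measurableSet_Ioc fun w hw => ?_
    simp only [norm_mul, norm_pow, Real.norm_eq_abs]
    rw [abs_of_nonneg (Real.rpow_nonneg hw.1.le _), abs_of_pos hw.1]
  have hsum := hasSum_integral_of_summable_integral_norm
    (μ := volume.restrict (Ioc (0 : ℝ) 1)) (F := fun n w => w ^ (b - 1) * (x * w) ^ n)
    (hint x) (by
      simp_rw [hnorm]
      refine Summable.of_nonneg_of_le (fun n => by have := hbn n; positivity) (fun n => ?_)
        ((summable_geometric_of_lt_one (abs_nonneg x) habs).mul_right (1 / b))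
      gcongr
      simp)
  simp_rw [hval] at hsum
  have h1 : ∫ w in Ioc (0 : ℝ) 1, ∑' n : ℕ, w ^ (b - 1) * (x * w) ^ n =
      ∫ w in Ioc (0 : ℝ) 1, w ^ (b - 1) / (1 - x * w) := by
    refine setIntegral_congr_fun measurableSet_Ioc fun w hw => ?_
    have h2 : |x * w| < 1 := by
      rw [abs_mul, abs_of_pos hw.1]
      exact (mul_le_of_le_one_right (abs_nonneg x) hw.2).trans_lt habs
    simp only [tsum_mul_left, tsum_geometric_of_abs_lt_one h2]
    rfl
  rw [← h1, ← hsum.tsum_eq, ← tsum_mul_left, ordinaryHypergeometric_eq_tsum]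
  refine tsum_congr fun n => ?_
  rw [ascPochhammer_eval_one, inv_mul_cancel₀ (by positivity), one_mul, ascPochhammer_eval_div hb,
    smul_eq_mul]
  ring

/-- Complex differentiability gives analyticity; the real function is the real part of the
restriction to the real axis. -/
theorem isGaussContinuation_eulerIntegral {b : ℝ} (hb : 0 < b) :
    IsGaussContinuation 1 b (b + 1) fun x => b * ∫ w in Ioc (0 : ℝ) 1, w ^ (b - 1) / (1 - x * w) := by
  refine ⟨fun x hx => ?_, fun x hx => (ordinaryHypergeometric_one_eq_integral hb hx).symm⟩
  have h1 := ((differentiableOn_eulerIntegral hb).analyticAt (z := (x : ℂ))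
    ((isOpen_lt Complex.continuous_re continuous_const).mem_nhds (by simpa using hx))).re_ofReal
  refine analyticAt_const.mul (h1.congr (Eventually.of_forall fun y => ?_))
  have h2 : ∀ w : ℝ, ((w ^ (b - 1) : ℝ) : ℂ) / (1 - y * w) =
      ((w ^ (b - 1) / (1 - y * w) : ℝ) : ℂ) := fun w => by push_cast; rfl
  simp_rw [h2]
  rw [integral_complex_ofReal, Complex.ofReal_re]

/-- Euler's integral with `b = 1 - δ`, whose prefactor cancels `1 / (1 - δ)`. The continuation is
essential: for `γ ≥ 1` the point `-γ` lies outside the interval on which it is given by the series.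
-/
theorem kappa2_eq_integral {δ γ : ℝ} (hδ1 : δ < 1) (hγ : 0 < γ) :
    kappa2 δ γ = δ * γ * ∫ x in Ioc (0 : ℝ) 1, x ^ (-δ) / (1 + γ * x) := by
  have hb : 0 < 1 - δ := by linarith
  rw [kappa2, show 2 - δ = (1 - δ) + 1 by ring,
    gaussHypergeometric_eq (isGaussContinuation_eulerIntegral hb) (by linarith)]
  simp only [show 1 - δ - 1 = -δ by ring, neg_mul, sub_neg_eq_add]
  field_simp

/-! ### Monotonicity and planar integral of the hit factor -/

section HitFactor

variable {a α γ : ℝ}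

theorem hitFactor_nonneg (ha1 : a ≤ 1) (hγ : 0 < γ) {r y : ℝ} (hr : 0 ≤ r) (hy : 0 ≤ y) :
    0 ≤ hitFactor a α γ r y := by
  unfold hitFactor
  have : 0 ≤ 1 - a := by linarith
  split_ifs <;> positivity

theorem hitFactor_le_one (ha : 0 ≤ a) (hγ : 0 < γ) {r y : ℝ} (hr : 0 ≤ r) (hy : 0 ≤ y) :
    hitFactor a α γ r y ≤ 1 := by
  unfold hitFactor
  have : 0 ≤ γ * r ^ α * y ^ (-α) := by positivity
  rw [div_le_one (by linarith)]
  split_ifs <;> linarith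

/-- A more distant server is weaker relative to the interference and requires more stations to be
silent. This monotonicity drives the sandwich over annuli. -/
theorem hitFactor_anti (ha : 0 ≤ a) (ha1 : a ≤ 1) (hα : 0 < α) (hγ : 0 < γ) {r r' y : ℝ}
    (hr : 0 ≤ r) (hrr' : r ≤ r') (hy : 0 ≤ y) : hitFactor a α γ r' y ≤ hitFactor a α γ r y := by
  unfold hitFactor
  have h1 : r ^ α ≤ r' ^ α := Real.rpow_le_rpow hr hrr' hα.le
  have h2 : 0 ≤ r ^ α := Real.rpow_nonneg hr _
  have h3 : 0 ≤ y ^ (-α) := Real.rpow_nonneg hy _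
  have h4 : (if y < r' then 1 - a else 1) ≤ (if y < r then 1 - a else 1 : ℝ) := by
    split_ifs <;> linarith
  have h5 : 0 ≤ (if y < r then 1 - a else 1 : ℝ) := by split_ifs <;> linarith
  have h6 : 0 ≤ γ * r ^ α * y ^ (-α) := by positivity
  gcongr

theorem measurable_hitFactor (a α γ r : ℝ) : Measurable (hitFactor a α γ r) := by
  unfold hitFactor
  exact (Measurable.ite measurableSet_Iio measurable_const measurable_const).div (by fun_prop)

/-- The integrand after the substitution `y = r x ^ (-1 / α)`. -/
theorem one_sub_hitFactor_subst (hα : 0 < α) (hγ : 0 < γ) {r x : ℝ} (hr : 0 < r) (hx : 0 < x) :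
    1 - hitFactor a α γ r (r * x ^ (-(1 / α))) =
      (if 1 < x then a else 0) / (1 + γ * x) + γ * x / (1 + γ * x) := by
  have hc : 0 < 1 + γ * x := by positivity
  -- Here `x = (r / y) ^ α` is the mean power received from distance `y` relative to the server's,
  -- so nearer stations are those with `x > 1`.
  have h1 : r * x ^ (-(1 / α)) < r ↔ 1 < x := by
    rw [mul_lt_iff_lt_one_right hr, Real.rpow_neg hx.le, inv_lt_one_iff₀]
    have h2 : 0 < x ^ (1 / α) := by positivity
    rw [Real.one_lt_rpow_iff_of_pos hx]
    have h3 : 0 < 1 / α := by positivity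
    constructor
    · rintro (h | h | h)
      · linarith
      · exact h.1
      · linarith [h.2]
    · exact fun h => Or.inr (Or.inl ⟨h, h3⟩)
  have h2 : γ * r ^ α * (r * x ^ (-(1 / α))) ^ (-α) = γ * x := by
    rw [Real.mul_rpow hr.le (by positivity), ← Real.rpow_mul hx.le,
      show -(1 / α) * -α = 1 by field_simp, Real.rpow_one, Real.rpow_neg hr.le]
    field_simp
  unfold hitFactor
  rw [h2]
  simp only [h1]
  split_ifs
  · field_simp
    ring
  · field_simp
    ring

theorem integral_one_sub_hitFactor_aux (hα : 2 < α) (hγ : 0 < γ) :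
    IntegrableOn (fun x : ℝ => x ^ (-(2 / α) - 1) *
      ((if 1 < x then a else 0) / (1 + γ * x) + γ * x / (1 + γ * x))) (Ioi 0) ∧
    2 / α * ∫ x in Ioi (0 : ℝ), x ^ (-(2 / α) - 1) *
      ((if 1 < x then a else 0) / (1 + γ * x) + γ * x / (1 + γ * x)) =
      a * tau1 (2 / α) γ + kappa1 (2 / α) γ := by
  have hα0 : 0 < α := by linarith
  set δ := 2 / α with hδdef
  have hδ : 0 < δ := by positivity
  have hδ1 : δ < 1 := by rw [hδdef, div_lt_one hα0]; exact hα
  set k : ℝ → ℝ := fun x => x ^ (-δ) / (1 + γ * x) with hk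
  have hkint : IntegrableOn k (Ioi 0) := by
    have h := integrableOn_rpow_div_one_add (b := 1 - δ) (by linarith) (by linarith) hγ
    rwa [show 1 - δ - 1 = -δ by ring] at h
  have hpint : IntegrableOn (fun x : ℝ => x ^ (-δ - 1)) (Ioi 1) :=
    integrableOn_Ioi_rpow_of_lt (by linarith) one_pos
  -- For `x > 1`, `a / (1 + γ x) = a - a γ x / (1 + γ x)`. After integration and multiplication by
  -- `δ`, the three terms on the right become `a`, `a κ₂` and `(1 - a) κ₁`.
  have heq : ∀ x ∈ Ioi (0 : ℝ), x ^ (-δ - 1) *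
      ((if 1 < x then a else 0) / (1 + γ * x) + γ * x / (1 + γ * x)) =
      a * (Ioi (1 : ℝ)).indicator (fun x => x ^ (-δ - 1)) x +
        (a * γ * (Ioc (0 : ℝ) 1).indicator k x + (1 - a) * γ * k x) := by
    intro x hx
    have hx0 : (0 : ℝ) < x := hx
    have hc : 0 < 1 + γ * x := by positivity
    have h1 : x ^ (-δ) = x ^ (-δ - 1) * x := by
      rw [← Real.rpow_add_one hx0.ne']; congr 1; ring
    by_cases hx1 : 1 < x
    · have h2 : x ∉ Ioc (0 : ℝ) 1 := fun h => absurd h.2 (not_le.2 hx1)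
      rw [if_pos hx1, Set.indicator_of_mem (show x ∈ Ioi (1 : ℝ) from hx1),
        Set.indicator_of_notMem h2]
      simp only [hk, h1]
      field_simp
      ring
    · have h2 : x ∈ Ioc (0 : ℝ) 1 := ⟨hx0, not_lt.1 hx1⟩
      rw [if_neg hx1, Set.indicator_of_notMem (show x ∉ Ioi (1 : ℝ) from hx1),
        Set.indicator_of_mem h2]
      simp only [hk, h1]
      field_simp
      ring
  have i1 : IntegrableOn (fun x => a * (Ioi (1 : ℝ)).indicator (fun x => x ^ (-δ - 1)) x)
      (Ioi 0) :=
    (((integrable_indicator_iff measurableSet_Ioi).2 hpint).const_mul a).integrableOn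
  have i2 : IntegrableOn (fun x => a * γ * (Ioc (0 : ℝ) 1).indicator k x) (Ioi 0) :=
    (((integrable_indicator_iff measurableSet_Ioc).2
      (hkint.mono_set Ioc_subset_Ioi_self)).const_mul _).integrableOn
  have i3 : IntegrableOn (fun x => (1 - a) * γ * k x) (Ioi 0) := hkint.const_mul _
  have i23 : IntegrableOn (fun x => a * γ * (Ioc (0 : ℝ) 1).indicator k x + (1 - a) * γ * k x)
      (Ioi 0) := i2.add i3
  refine ⟨(integrableOn_congr_fun heq measurableSet_Ioi).2 (i1.add i23), ?_⟩
  rw [setIntegral_congr_fun measurableSet_Ioi heq, integral_add i1 i23,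
    integral_add i2 i3, integral_const_mul, integral_const_mul, integral_const_mul,
    setIntegral_indicator measurableSet_Ioi, setIntegral_indicator measurableSet_Ioc,
    Ioi_inter_Ioi, Set.inter_eq_right.2 Ioc_subset_Ioi_self, tau1, kappa1_eq_integral hδ hδ1 hγ,
    kappa2_eq_integral hδ1 hγ, max_eq_right zero_le_one,
    integral_Ioi_rpow_of_lt (by linarith) one_pos]
  simp only [hk, Real.one_rpow, show -δ - 1 + 1 = -δ by ring, neg_div_neg_eq]
  linear_combination a * mul_one_div_cancel hδ.ne'

/-- Polar coordinates, then `y = r x ^ (-1 / α)`: scaling produces the factor `r ^ 2`, and the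
remaining integral does not depend on `r`. -/
theorem lintegral_one_sub_hitFactor (ha : 0 ≤ a) (hα : 2 < α) (hγ : 0 < γ) {r : ℝ}
    (hr : 0 ≤ r) :
    ∫⁻ y : Plane, ENNReal.ofReal (1 - hitFactor a α γ r ‖y‖) =
      ENNReal.ofReal (Real.pi * r ^ 2 * (a * tau1 (2 / α) γ + kappa1 (2 / α) γ)) := by
  have hα0 : 0 < α := by linarith
  rcases hr.eq_or_lt with rfl | hr
  · have : ∀ y : Plane, hitFactor a α γ 0 ‖y‖ = 1 := fun y => by
      simp [hitFactor, Real.zero_rpow hα0.ne']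
    simp [this]
  obtain ⟨hint, hval⟩ := integral_one_sub_hitFactor_aux (a := a) hα hγ
  set G : ℝ → ℝ := fun x => x ^ (-(2 / α) - 1) *
      ((if 1 < x then a else 0) / (1 + γ * x) + γ * x / (1 + γ * x)) with hG
  set f : ℝ → ℝ := fun y => y * (1 - hitFactor a α γ r y) with hf
  have hp : -(1 / α) ≠ 0 := by
    have : 0 < 1 / α := by positivity
    linarith
  have hsub : ∀ x ∈ Ioi (0 : ℝ), (|(-(1 / α))| * x ^ (-(1 / α) - 1)) •
      f (r * x ^ (-(1 / α))) = r / α * G x := by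
    intro x hx
    have hx0 : (0 : ℝ) < x := hx
    rw [hf, hG]
    simp only [smul_eq_mul]
    rw [one_sub_hitFactor_subst hα0 hγ hr hx0, abs_neg, abs_of_pos (by positivity)]
    have : x ^ (-(2 / α) - 1) = x ^ (-(1 / α) - 1) * x ^ (-(1 / α)) := by
      rw [← Real.rpow_add hx0]; congr 1; ring
    rw [this]
    ring
  have hfint : IntegrableOn f (Ioi 0) := by
    have h1 : IntegrableOn (fun y => f (r * y)) (Ioi 0) := by
      rw [← integrableOn_Ioi_comp_rpow_iff (fun y => f (r * y)) hp]
      exact (integrableOn_congr_fun hsub measurableSet_Ioi).2 (hint.const_mul _)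
    rw [integrableOn_Ioi_comp_mul_left_iff f 0 hr, mul_zero] at h1
    exact h1
  have hfval : ∫ y in Ioi (0 : ℝ), f y = r ^ 2 / α * ∫ x in Ioi (0 : ℝ), G x := by
    have h1 := integral_comp_mul_left_Ioi f 0 hr
    rw [mul_zero, ← integral_comp_rpow_Ioi (fun y => f (r * y)) hp,
      setIntegral_congr_fun measurableSet_Ioi hsub, integral_const_mul, smul_eq_mul] at h1
    have h2 : ∫ y in Ioi (0 : ℝ), f y = r * (r / α * ∫ x in Ioi (0 : ℝ), G x) := by
      rw [h1]; field_simp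
    rw [h2]
    ring
  have hpi : (volume : Measure Plane).real (Metric.ball 0 1) = Real.pi := by
    rw [measureReal_def, EuclideanSpace.volume_ball_fin_two]
    simp [Real.pi_nonneg]
  rw [← ofReal_integral_eq_lintegral_ofReal]
  · congr 1
    rw [integral_fun_norm_addHaar volume (fun y => 1 - hitFactor a α γ r y), hpi]
    simp only [finrank_euclideanSpace, Fintype.card_fin, Nat.add_one_sub_one, pow_one, smul_eq_mul,
      nsmul_eq_mul, Nat.cast_ofNat]
    rw [hfval, ← hval]
    ring
  · rw [integrable_fun_norm_addHaar volume (f := fun y => 1 - hitFactor a α γ r y)]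
    simpa using hfint
  · exact Eventually.of_forall fun y => by
      simpa using hitFactor_le_one ha hγ hr.le (norm_nonneg y)

end HitFactor

/-! ### Annuli of equal intensity -/

section Annuli

variable {lam ε : ℝ}

/-- The index of the annulus that contains `y`, when the plane is divided into annuli of
intensity `ε` around the origin. -/
def annulusIndex (lam ε : ℝ) (y : Plane) : ℕ := ⌊lam * Real.pi * ‖y‖ ^ 2 / ε⌋₊

/-- The inner radius of the `j`-th annulus. -/
def innerRadius (lam ε : ℝ) (j : ℕ) : ℝ := √(j * ε / (lam * Real.pi))

theorem innerRadius_nonneg (j : ℕ) : 0 ≤ innerRadius lam ε j := Real.sqrt_nonneg _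

theorem innerRadius_sq (hlam : 0 < lam) (hε : 0 < ε) (j : ℕ) :
    lam * (Real.pi * innerRadius lam ε j ^ 2) = j * ε := by
  have := Real.pi_pos
  rw [innerRadius, Real.sq_sqrt (by positivity)]
  field_simp

theorem measurable_annulusIndex : Measurable (annulusIndex lam ε) :=
  Nat.measurable_floor.comp (by fun_prop)

theorem annulusIndex_eq_iff (hlam : 0 < lam) (hε : 0 < ε) {y : Plane} {j : ℕ} :
    annulusIndex lam ε y = j ↔ innerRadius lam ε j ≤ ‖y‖ ∧ ‖y‖ < innerRadius lam ε (j + 1) := by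
  have := Real.pi_pos
  rw [annulusIndex, Nat.floor_eq_iff (by positivity), innerRadius, innerRadius,
    Real.sqrt_le_left (norm_nonneg y), Real.lt_sqrt (norm_nonneg y), le_div_iff₀ hε,
    div_lt_iff₀ hε, div_le_iff₀ (by positivity), lt_div_iff₀ (by positivity)]
  push_cast
  rw [mul_comm (‖y‖ ^ 2)]

theorem intensity_annulus (hlam : 0 < lam) (hε : 0 < ε) (j : ℕ) :
    (ENNReal.ofReal lam • (volume : Measure Plane)) (annulusIndex lam ε ⁻¹' {j}) =
      ENNReal.ofReal ε := by
  have h1 : annulusIndex lam ε ⁻¹' {j} =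
      Metric.ball (0 : Plane) (innerRadius lam ε (j + 1)) \
        Metric.ball 0 (innerRadius lam ε j) := by
    ext y
    simp only [Set.mem_preimage, Set.mem_singleton_iff, annulusIndex_eq_iff hlam hε,
      Set.mem_sdiff, mem_ball_zero_iff, not_lt]
    exact and_comm
  have h2 : innerRadius lam ε j ≤ innerRadius lam ε (j + 1) := by
    have := Real.pi_pos
    unfold innerRadius
    gcongr
    simp
  have h3 : ∀ k, (volume : Measure Plane) (Metric.ball 0 (innerRadius lam ε k)) =
      ENNReal.ofReal (Real.pi * innerRadius lam ε k ^ 2) := fun k => by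
    rw [EuclideanSpace.volume_ball_fin_two, ← ENNReal.ofReal_pow (innerRadius_nonneg k),
      mul_comm, ENNReal.ofReal_mul Real.pi_nonneg]
  rw [h1, Measure.smul_apply, measure_sdiff (Metric.ball_subset_ball h2)
    measurableSet_ball.nullMeasurableSet measure_ball_lt_top.ne, h3, h3,
    ← ENNReal.ofReal_sub _ (by have := Real.pi_pos; positivity), smul_eq_mul,
    ← ENNReal.ofReal_mul hlam.le, mul_sub, innerRadius_sq hlam hε, innerRadius_sq hlam hε]
  congr 1
  push_cast
  ring

/-- Summing over points is summing over the classes of points, weighted by their numbers. -/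
theorem tsum_comp_eq_tsum_encard {E : Type*} {x : ℕ → E} (hx : Function.Injective x) (c : E → ℕ)
    (K : ℕ → ℝ≥0∞) :
    ∑' b, K (c (x b)) = ∑' j, ((range x ∩ c ⁻¹' {j}).encard : ℝ≥0∞) * K j := by
  have h1 : ∀ b, K (c (x b)) = ∑' j, (x ⁻¹' (c ⁻¹' {j})).indicator 1 b * K j := by
    intro b
    rw [tsum_eq_single (c (x b))]
    · simp
    · intro j hj
      simp [Ne.symm hj]
  rw [tsum_congr h1, ENNReal.tsum_comm]
  refine tsum_congr fun j => ?_
  rw [ENNReal.tsum_mul_right, ← tsum_subtype, encard_range_inter hx]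
  congr 1
  simp

end Annuli

/-! ### Bounds for the hit probability given the locations -/

/-- One minus the factor contributed by a point `y` outside the `j`-th class. -/
def offClassLoss (a α γ : ℝ) (c : Plane → ℕ) (j : ℕ) (r : ℝ) (y : Plane) : ℝ≥0∞ :=
  if c y = j then 0 else ENNReal.ofReal (1 - hitFactor a α γ r ‖y‖)

section OffClassLoss

variable {a α γ r : ℝ} {c : Plane → ℕ} {j : ℕ} {y : Plane}

theorem offClassLoss_le_one (ha1 : a ≤ 1) (hγ : 0 < γ) (hr : 0 ≤ r) :
    offClassLoss a α γ c j r y ≤ 1 := by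
  unfold offClassLoss
  split_ifs
  · simp
  · have := hitFactor_nonneg (α := α) ha1 hγ hr (norm_nonneg y)
    exact ENNReal.ofReal_le_one.2 (by linarith)

theorem one_sub_offClassLoss_of_eq (h : c y = j) : 1 - offClassLoss a α γ c j r y = 1 := by
  simp [offClassLoss, h]

theorem one_sub_offClassLoss_of_ne (ha : 0 ≤ a) (hγ : 0 < γ) (hr : 0 ≤ r)
    (h : c y ≠ j) : 1 - offClassLoss a α γ c j r y = ENNReal.ofReal (hitFactor a α γ r ‖y‖) := by
  have h1 := hitFactor_le_one (α := α) ha hγ hr (norm_nonneg y)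
  rw [offClassLoss, if_neg h, ← ENNReal.ofReal_one, ← ENNReal.ofReal_sub _ (by linarith)]
  congr 1
  ring

theorem measurable_offClassLoss (hc : Measurable c) : Measurable (offClassLoss a α γ c j r) :=
  Measurable.ite (hc (measurableSet_singleton j)) measurable_const
    (measurable_const.sub ((measurable_hitFactor a α γ r).comp measurable_norm)).ennreal_ofReal

end OffClassLoss

section Network

variable {Ω : Type*} [MeasurableSpace Ω] {μ : Measure Ω} [IsProbabilityMeasure μ] {F : ℕ}
  {lam lamE D P α γ : ℝ} {p : Fin F → ℝ} {X : ℕ → Ω → Plane} {Φe : Ω → Set Plane}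
  {cache : ℕ → Ω → Set (Fin F)} {active : ℕ → Ω → Bool} {h : ℕ → Ω → ℝ}

/-- The hit probability of file `i`, given the locations of the base stations. -/
def hitProbGiven (μ : Measure Ω) (P α γ : ℝ) (cache : ℕ → Ω → Set (Fin F))
    (active : ℕ → Ω → Bool) (h : ℕ → Ω → ℝ) (i : Fin F) (x : ℕ → Plane) : ℝ≥0∞ :=
  μ {ω | ∃ b, IsHitBy P α γ x (fun n => cache n ω) (fun n => active n ω) (fun n => h n ω) i b}

/-- Locations and marks are independent, so their joint law is a product and Fubini applies. -/
theorem IsNetwork.measure_hit_eq_lintegral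
    (hnet : IsNetwork μ lam lamE D p X Φe cache active h) (i : Fin F) :
    μ {ω | ∃ b, IsHitBy P α γ (fun n => X n ω) (fun n => cache n ω) (fun n => active n ω)
        (fun n => h n ω) i b} =
      ∫⁻ ω, hitProbGiven μ P α γ cache active h i (fun n => X n ω) ∂μ := by
  have hX : Measurable fun ω n => X n ω := measurable_pi_lambda _ hnet.measurable_loc
  have hM : Measurable fun ω n => (cache n ω, active n ω, h n ω) :=
    measurable_pi_lambda _ fun n => (hnet.measurable_cache n).prodMk
      ((hnet.measurable_active n).prodMk (hnet.measurable_fading n))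
  have hS : MeasurableSet {z : (ℕ → Plane) × (ℕ → Set (Fin F) × Bool × ℝ) |
      ∃ b, IsHitBy P α γ z.1 (fun n => (z.2 n).1) (fun n => (z.2 n).2.1)
        (fun n => (z.2 n).2.2) i b} := by
    rw [Set.ofPred_exists]
    exact MeasurableSet.iUnion fun b => measurableSet_isHitBy P α γ i b
  have h1 := (indepFun_iff_map_prod_eq_prod_map_map hX.aemeasurable hM.aemeasurable).1
    hnet.indep_loc_marks
  have := Measure.isProbabilityMeasure_map (μ := μ) hX.aemeasurable
  have := Measure.isProbabilityMeasure_map (μ := μ) hM.aemeasurable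
  have h2 := Measure.map_apply (μ := μ) (hX.prodMk hM) hS
  rw [h1, Measure.prod_apply hS, lintegral_map (measurable_measure_prodMk_left hS) hX] at h2
  refine h2.symm.trans (lintegral_congr fun ω => ?_)
  rw [Measure.map_apply hM (measurable_prodMk_left hS)]
  rfl

/-- Union bound over `b`. Rounding the distance of `b` down to the inner radius and replacing the
factors of its own annulus by one makes the bound depend on `b` only through its annulus, whence the
weight by the count. -/
theorem IsNetwork.hitProbGiven_le (hnet : IsNetwork μ lam lamE D p X Φe cache active h)
    (hlam : 0 < lam) (hlamE : 0 ≤ lamE) (hD : 0 ≤ D) (hP : 0 < P) (hα : 0 < α) (hγ : 0 < γ)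
    (i : Fin F) {a : ℝ} (ha : a = p i * Real.exp (-(Real.pi * lamE * D ^ 2))) (ha0 : 0 ≤ a)
    (ha1 : a ≤ 1) {ε : ℝ} (hε : 0 < ε) {x : ℕ → Plane} (hx : ∀ n, x n ≠ 0)
    (hinj : Function.Injective x) :
    hitProbGiven μ P α γ cache active h i x ≤ ENNReal.ofReal a *
      ∑' j, ((range x ∩ annulusIndex lam ε ⁻¹' {j}).encard : ℝ≥0∞) * infProd fun n =>
        1 - offClassLoss a α γ (annulusIndex lam ε) j (innerRadius lam ε j) (x n) := by
  rw [← tsum_comp_eq_tsum_encard hinj (annulusIndex lam ε) fun j => infProd fun n =>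
      1 - offClassLoss a α γ (annulusIndex lam ε) j (innerRadius lam ε j) (x n),
    hitProbGiven, Set.ofPred_exists, ← ENNReal.tsum_mul_left]
  refine (measure_iUnion_le _).trans (ENNReal.tsum_le_tsum fun b => ?_)
  rw [hnet.measure_isHitBy hlamE hD hP hα hγ i hx b ha]
  refine mul_le_mul_right (infProd_mono fun n => ?_) _
  split_ifs with hn
  · subst hn
    rw [one_sub_offClassLoss_of_eq rfl]
  · have h1 := ((annulusIndex_eq_iff hlam hε (y := x b)).1 rfl).1
    by_cases hc : annulusIndex lam ε (x n) = annulusIndex lam ε (x b)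
    · rw [one_sub_offClassLoss_of_eq hc]
      exact ENNReal.ofReal_le_one.2 (hitFactor_le_one ha0 hγ (norm_nonneg _) (norm_nonneg _))
    · rw [one_sub_offClassLoss_of_ne ha0 hγ (innerRadius_nonneg _) hc]
      exact ENNReal.ofReal_le_ofReal
        (hitFactor_anti ha0 ha1 hα hγ (innerRadius_nonneg _) h1 (norm_nonneg _))

/-- Only stations alone in their annulus are kept, with distance rounded up to the outer radius. No
other station shares the annulus, so discarding its factors loses nothing there. -/
theorem IsNetwork.le_hitProbGiven (hnet : IsNetwork μ lam lamE D p X Φe cache active h)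
    (hlam : 0 < lam) (hlamE : 0 ≤ lamE) (hD : 0 ≤ D) (hP : 0 < P) (hα : 0 < α) (hγ : 0 < γ)
    (i : Fin F) {a : ℝ} (ha : a = p i * Real.exp (-(Real.pi * lamE * D ^ 2))) (ha0 : 0 ≤ a)
    (ha1 : a ≤ 1) {ε : ℝ} (hε : 0 < ε) {x : ℕ → Plane} (hx : ∀ n, x n ≠ 0)
    (hinj : Function.Injective x) :
    ENNReal.ofReal a * ∑' j, (if (range x ∩ annulusIndex lam ε ⁻¹' {j}).encard = 1 then 1 else 0) *
      (infProd fun n =>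
        1 - offClassLoss a α γ (annulusIndex lam ε) j (innerRadius lam ε (j + 1)) (x n)) ≤
    hitProbGiven μ P α γ cache active h i x := by
  classical
  set c := annulusIndex lam ε with hc
  let I : Set ℕ := {b | (range x ∩ c ⁻¹' {c (x b)}).encard = 1}
  have huniq : ∀ b ∈ I, ∀ n, c (x n) = c (x b) → n = b := by
    intro b hb n hn
    obtain ⟨y, hy⟩ := Set.encard_eq_one.1 hb
    have h1 : x n ∈ range x ∩ c ⁻¹' {c (x b)} := ⟨mem_range_self n, hn⟩
    have h2 : x b ∈ range x ∩ c ⁻¹' {c (x b)} := ⟨mem_range_self b, rfl⟩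
    rw [hy] at h1 h2
    exact hinj (h1.trans h2.symm)
  let A : ℕ → Set Ω := fun b => {ω | IsHitBy P α γ x (fun n => cache n ω) (fun n => active n ω)
    (fun n => h n ω) i b}
  have hM : Measurable fun ω n => (cache n ω, active n ω, h n ω) :=
    measurable_pi_lambda _ fun n => (hnet.measurable_cache n).prodMk
      ((hnet.measurable_active n).prodMk (hnet.measurable_fading n))
  have hA : ∀ b, MeasurableSet (A b) := fun b =>
    hM (measurable_prodMk_left (x := x) (measurableSet_isHitBy P α γ i b))
  -- Two simultaneous servers would be equidistant from the origin, hence in the same annulus, which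
  -- isolation forbids.
  have hdisj : Pairwise (Function.onFun Disjoint fun b : I => A b) := by
    intro b b' hbb'
    refine Set.disjoint_left.2 fun ω hb hb' => hbb' (Subtype.ext ?_)
    have h1 := (isServing_iff hP hα hx).1 hb.1
    have h2 := (isServing_iff hP hα hx).1 hb'.1
    by_contra hne
    have h3 : ¬ ‖x b‖ < ‖x b'‖ := fun hlt => h2.2 b hne hlt h1.1
    have h4 : ¬ ‖x b'‖ < ‖x b‖ := fun hlt => h1.2 b' (Ne.symm hne) hlt h2.1
    have h5 : ‖x b‖ = ‖x b'‖ := le_antisymm (not_lt.1 h4) (not_lt.1 h3)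
    refine hne (huniq b' b'.2 b ?_)
    simp only [hc, annulusIndex, h5]
  have hsum : ∑' b : I, μ (A b) ≤ hitProbGiven μ P α γ cache active h i x := by
    rw [← measure_iUnion hdisj fun b => hA b]
    refine measure_mono fun ω hω => ?_
    obtain ⟨b, hb⟩ := Set.mem_iUnion.1 hω
    exact ⟨b, hb⟩
  refine le_trans ?_ hsum
  have h1 : ∀ j, (if (range x ∩ c ⁻¹' {j}).encard = 1 then (1 : ℝ≥0∞) else 0) *
      (infProd fun n => 1 - offClassLoss a α γ c j (innerRadius lam ε (j + 1)) (x n)) =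
      ((range x ∩ c ⁻¹' {j}).encard : ℝ≥0∞) *
        if (range x ∩ c ⁻¹' {j}).encard = 1 then
          (infProd fun n => 1 - offClassLoss a α γ c j (innerRadius lam ε (j + 1)) (x n))
        else 0 := by
    intro j
    split_ifs with hj
    · simp [hj]
    · simp
  rw [tsum_congr h1, ← tsum_comp_eq_tsum_encard hinj c fun j =>
    if (range x ∩ c ⁻¹' {j}).encard = 1 then
      (infProd fun n => 1 - offClassLoss a α γ c j (innerRadius lam ε (j + 1)) (x n)) else 0,
    tsum_subtype I fun b => μ (A b), ← ENNReal.tsum_mul_left]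
  refine ENNReal.tsum_le_tsum fun b => ?_
  rw [Set.indicator_apply]
  by_cases hb : b ∈ I
  · rw [if_pos hb, if_pos (show (range x ∩ c ⁻¹' {c (x b)}).encard = 1 from hb),
      hnet.measure_isHitBy hlamE hD hP hα hγ i hx b ha]
    refine mul_le_mul_right (infProd_mono fun n => ?_) _
    split_ifs with hn
    · exact tsub_le_self
    · have h2 := ((annulusIndex_eq_iff hlam hε (y := x b)).1 rfl).2
      rw [one_sub_offClassLoss_of_ne ha0 hγ (innerRadius_nonneg _)
        fun hcn => hn (huniq b hb n hcn)]
      exact ENNReal.ofReal_le_ofReal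
        (hitFactor_anti ha0 ha1 hα hγ (norm_nonneg _) h2.le (norm_nonneg _))
  · rw [if_neg hb, if_neg (show ¬ (range x ∩ c ⁻¹' {c (x b)}).encard = 1 from hb), mul_zero]

end Network

section OffClassIntegral

variable {a α γ lam ε : ℝ}

/-- The intensity integral of the loss outside the `j`-th annulus, from above. -/
theorem lintegral_offClassLoss_le (ha0 : 0 ≤ a) (hα : 2 < α) (hγ : 0 < γ)
    (hlam : 0 < lam) (hε : 0 < ε) (j k : ℕ) :
    ∫⁻ y, offClassLoss a α γ (annulusIndex lam ε) j (innerRadius lam ε k) y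
        ∂(ENNReal.ofReal lam • (volume : Measure Plane)) ≤
      ENNReal.ofReal (k * ε * (a * tau1 (2 / α) γ + kappa1 (2 / α) γ)) := by
  rw [lintegral_smul_measure]
  calc _ ≤ ENNReal.ofReal lam *
        ∫⁻ y : Plane, ENNReal.ofReal (1 - hitFactor a α γ (innerRadius lam ε k) ‖y‖) := by
        rw [smul_eq_mul]
        gcongr with y
        unfold offClassLoss
        split_ifs <;> simp
    _ = _ := by
        rw [lintegral_one_sub_hitFactor ha0 hα hγ (innerRadius_nonneg k),
          ← ENNReal.ofReal_mul hlam.le, ← mul_assoc, innerRadius_sq hlam hε]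

/-- The intensity integral of the loss outside the `j`-th annulus, from below. -/
theorem le_lintegral_offClassLoss_add (ha0 : 0 ≤ a) (ha1 : a ≤ 1) (hα : 2 < α) (hγ : 0 < γ)
    (hlam : 0 < lam) (hε : 0 < ε) (j k : ℕ) :
    ENNReal.ofReal (k * ε * (a * tau1 (2 / α) γ + kappa1 (2 / α) γ)) ≤
      ∫⁻ y, offClassLoss a α γ (annulusIndex lam ε) j (innerRadius lam ε k) y
        ∂(ENNReal.ofReal lam • (volume : Measure Plane)) + ENNReal.ofReal ε := by
  have hA : MeasurableSet (annulusIndex lam ε ⁻¹' {j}) :=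
    measurable_annulusIndex (measurableSet_singleton j)
  rw [← intensity_annulus hlam hε j, ← lintegral_indicator_one hA,
    ← lintegral_add_left (measurable_offClassLoss measurable_annulusIndex)]
  calc _ = ∫⁻ y : Plane, ENNReal.ofReal (1 - hitFactor a α γ (innerRadius lam ε k) ‖y‖)
        ∂(ENNReal.ofReal lam • (volume : Measure Plane)) := by
        rw [lintegral_smul_measure, smul_eq_mul,
          lintegral_one_sub_hitFactor ha0 hα hγ (innerRadius_nonneg k),
          ← ENNReal.ofReal_mul hlam.le, ← mul_assoc, innerRadius_sq hlam hε]
    _ ≤ _ := by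
        refine lintegral_mono fun y => ?_
        by_cases hy : annulusIndex lam ε y = j
        · have h1 := hitFactor_nonneg (α := α) ha1 hγ (innerRadius_nonneg (lam := lam) (ε := ε) k)
            (norm_nonneg y)
          rw [Set.indicator_of_mem (show y ∈ annulusIndex lam ε ⁻¹' {j} from hy)]
          exact (ENNReal.ofReal_le_one.2 (by linarith)).trans le_add_self
        · simp [offClassLoss, hy]

theorem tsum_ofReal_geometric {A s : ℝ} (hA : 0 ≤ A) (hs : 0 < s) :
    ∑' j : ℕ, ENNReal.ofReal (A * Real.exp (-(j * s))) =
      ENNReal.ofReal (A / (1 - Real.exp (-s))) := by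
  have h1 : Real.exp (-s) < 1 := by rw [Real.exp_lt_one_iff]; linarith
  have h2 := (hasSum_geometric_of_lt_one (Real.exp_nonneg (-s)) h1).mul_left A
  have h3 : ∀ j : ℕ, Real.exp (-s) ^ j = Real.exp (-(j * s)) := fun j => by
    rw [← Real.exp_nat_mul]; congr 1; ring
  simp_rw [h3] at h2
  rw [← ENNReal.ofReal_tsum_of_nonneg (fun j => by positivity) h2.summable, h2.tsum_eq]
  rfl

/-- The quotient is the reciprocal of the slope of `1 - exp (-ε C)` at zero. -/
theorem tendsto_div_one_sub_exp {C : ℝ} (hC : 0 < C) :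
    Tendsto (fun ε : ℝ => ε / (1 - Real.exp (-(ε * C)))) (𝓝[>] 0) (𝓝 (1 / C)) := by
  have h1 : HasDerivAt (fun ε : ℝ => 1 - Real.exp (-(ε * C))) C 0 := by
    have h2 := ((((hasDerivAt_id (0 : ℝ)).mul_const C).neg).exp).const_sub 1
    simpa using h2
  have h3 := (hasDerivAt_iff_tendsto_slope.1 h1).mono_left
    (nhdsWithin_mono 0 fun x (hx : 0 < x) => hx.ne')
  have h4 := h3.inv₀ hC.ne'
  rw [← one_div] at h4
  refine h4.congr fun ε => ?_
  simp [slope, mul_comm, div_eq_mul_inv]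

end OffClassIntegral

/-! ### Averaging over the locations and letting the annuli shrink -/

section Network

variable {Ω : Type*} [MeasurableSpace Ω] {μ : Measure Ω} {F : ℕ}
  {lam lamE D P α γ : ℝ} {p : Fin F → ℝ} {X : ℕ → Ω → Plane} {Φe : Ω → Set Plane}
  {cache : ℕ → Ω → Set (Fin F)} {active : ℕ → Ω → Bool} {h : ℕ → Ω → ℝ}

theorem IsNetwork.measurable_loss_prod (hnet : IsNetwork μ lam lamE D p X Φe cache active h)
    (a : ℝ) (ε : ℝ) (j k : ℕ) : Measurable fun ω => infProd fun n =>
      1 - offClassLoss a α γ (annulusIndex lam ε) j (innerRadius lam ε k) (X n ω) :=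
  measurable_infProd fun n => measurable_const.sub
    ((measurable_offClassLoss measurable_annulusIndex).comp (hnet.measurable_loc n))

theorem IsNetwork.measurable_count (hnet : IsNetwork μ lam lamE D p X Φe cache active h)
    (ψ : ℕ∞ → ℝ≥0∞) (ε : ℝ) (j : ℕ) :
    Measurable fun ω => ψ ((range fun n => X n ω) ∩ annulusIndex lam ε ⁻¹' {j}).encard :=
  (measurable_of_countable ψ).comp
    (hnet.loc_ppp.measurable_count _ (measurable_annulusIndex (measurableSet_singleton j)))

variable [IsProbabilityMeasure μ]

theorem IsNetwork.ae_ne_zero (hnet : IsNetwork μ lam lamE D p X Φe cache active h) :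
    ∀ᵐ ω ∂μ, ∀ n, X n ω ≠ 0 := by
  have h0 : (ENNReal.ofReal lam • (volume : Measure Plane)) {0} = 0 := by simp
  have h1 := hnet.loc_ppp.lintegral_encard (measurableSet_singleton 0) (by simp [h0])
  rw [h0, lintegral_eq_zero_iff (f := fun ω => (((range fun n => X n ω) ∩ {0}).encard : ℝ≥0∞))
    ((measurable_of_countable _).comp
    (hnet.loc_ppp.measurable_count {0} (measurableSet_singleton 0)))] at h1
  filter_upwards [h1] with ω hω n hn
  have h2 : ((range fun n => X n ω) ∩ {0}).encard = 0 := by simpa using hω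
  rw [Set.encard_eq_zero] at h2
  exact Set.notMem_empty (0 : Plane) (h2 ▸ ⟨⟨n, hn⟩, rfl⟩)

/-- The loss vanishes on annulus `j`, so the generating functional applies with any weight on the
count there. This plays the role of Mecke's formula. -/
theorem IsNetwork.lintegral_count_mul_loss_prod
    (hnet : IsNetwork μ lam lamE D p X Φe cache active h) (hlam : 0 < lam) (hα : 2 < α)
    (hγ : 0 < γ) {a : ℝ} (ha0 : 0 ≤ a) (ha1 : a ≤ 1) {ε : ℝ} (hε : 0 < ε) (j k : ℕ)
    (ψ : ℕ∞ → ℝ≥0∞)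
    (hψ : ∫⁻ ω, ψ ((range fun n => X n ω) ∩ annulusIndex lam ε ⁻¹' {j}).encard ∂μ ≠ ∞) :
    ∫⁻ ω, ψ ((range fun n => X n ω) ∩ annulusIndex lam ε ⁻¹' {j}).encard * (infProd fun n =>
        1 - offClassLoss a α γ (annulusIndex lam ε) j (innerRadius lam ε k) (X n ω)) ∂μ =
      (∫⁻ ω, ψ ((range fun n => X n ω) ∩ annulusIndex lam ε ⁻¹' {j}).encard ∂μ) *
        expNeg (∫⁻ y, offClassLoss a α γ (annulusIndex lam ε) j (innerRadius lam ε k) y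
          ∂(ENNReal.ofReal lam • (volume : Measure Plane))) :=
  lintegral_count_mul_infProd hnet.loc_ppp hnet.measurable_loc hnet.loc_injective
    (measurable_annulusIndex (measurableSet_singleton j)) ψ hψ
    (measurable_offClassLoss measurable_annulusIndex)
    (fun _ => offClassLoss_le_one ha1 hγ (innerRadius_nonneg k))
    (fun y (hy : annulusIndex lam ε y = j) => by simp [offClassLoss, hy])
    ((lintegral_offClassLoss_le ha0 hα hγ hlam hε j k).trans_lt ENNReal.ofReal_lt_top).ne

/-- Annulus `j` contains `ε` points on average, and the mean product is at most `exp ε * exp (-j ε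
C)`; the bound is a geometric series in `j`. -/
theorem IsNetwork.hitProb_le (hnet : IsNetwork μ lam lamE D p X Φe cache active h)
    (hlam : 0 < lam) (hlamE : 0 ≤ lamE) (hD : 0 ≤ D) (hP : 0 < P) (hα : 2 < α) (hγ : 0 < γ)
    (i : Fin F) {a : ℝ} (ha : a = p i * Real.exp (-(Real.pi * lamE * D ^ 2))) (ha0 : 0 ≤ a)
    (ha1 : a ≤ 1) {C : ℝ} (hC : C = a * tau1 (2 / α) γ + kappa1 (2 / α) γ) (hC0 : 0 < C)
    {ε : ℝ} (hε : 0 < ε) :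
    ∫⁻ ω, hitProbGiven μ P α γ cache active h i (fun n => X n ω) ∂μ ≤
      ENNReal.ofReal (a * Real.exp ε * (ε / (1 - Real.exp (-(ε * C))))) := by
  have hcount : ∀ j, ∫⁻ ω, (((range fun n => X n ω) ∩
      annulusIndex lam ε ⁻¹' {j}).encard : ℝ≥0∞) ∂μ = ENNReal.ofReal ε := fun j => by
    rw [← intensity_annulus hlam hε j]
    exact hnet.loc_ppp.lintegral_encard (measurable_annulusIndex (measurableSet_singleton j))
      (by rw [intensity_annulus hlam hε j]; exact ENNReal.ofReal_ne_top)
  -- Leaving out annulus `j` lowers the exponent `j ε C` by at most its intensity `ε`, which costs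
  -- the factor `exp ε`.
  have hexp : ∀ j : ℕ, expNeg (∫⁻ y, offClassLoss a α γ (annulusIndex lam ε) j
      (innerRadius lam ε j) y ∂(ENNReal.ofReal lam • (volume : Measure Plane))) ≤
      ENNReal.ofReal (Real.exp ε * Real.exp (-(j * (ε * C)))) := fun j => by
    have h1 := antitone_expNeg (le_lintegral_offClassLoss_add ha0 ha1 hα hγ hlam hε j j)
    rw [← hC, expNeg_add, expNeg_ofReal hε.le, expNeg_ofReal (by positivity)] at h1
    rw [ENNReal.ofReal_mul (Real.exp_nonneg _)]
    calc _ = ENNReal.ofReal (Real.exp ε) * (expNeg (∫⁻ y, offClassLoss a α γ (annulusIndex lam ε) j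
          (innerRadius lam ε j) y ∂(ENNReal.ofReal lam • (volume : Measure Plane))) *
          ENNReal.ofReal (Real.exp (-ε))) := by
          rw [mul_left_comm, ← ENNReal.ofReal_mul (Real.exp_nonneg _), ← Real.exp_add]
          simp
      _ ≤ _ := by
          rw [← mul_assoc (j : ℝ)]
          gcongr
  calc _ ≤ ∫⁻ ω, ENNReal.ofReal a * ∑' j,
        (((range fun n => X n ω) ∩ annulusIndex lam ε ⁻¹' {j}).encard : ℝ≥0∞) *
        (infProd fun n =>
          1 - offClassLoss a α γ (annulusIndex lam ε) j (innerRadius lam ε j) (X n ω)) ∂μ := by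
        refine lintegral_mono_ae ?_
        filter_upwards [hnet.ae_ne_zero, hnet.loc_injective] with ω h0 hinj
        exact hnet.hitProbGiven_le hlam hlamE hD hP (by linarith) hγ i ha ha0 ha1 hε h0 hinj
    _ = ENNReal.ofReal a * ∑' j, ENNReal.ofReal ε *
        expNeg (∫⁻ y, offClassLoss a α γ (annulusIndex lam ε) j (innerRadius lam ε j) y
          ∂(ENNReal.ofReal lam • (volume : Measure Plane))) := by
        have hm : ∀ j, Measurable fun ω =>
            (((range fun n => X n ω) ∩ annulusIndex lam ε ⁻¹' {j}).encard : ℝ≥0∞) *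
            (infProd fun n => 1 - offClassLoss a α γ (annulusIndex lam ε) j
              (innerRadius lam ε j) (X n ω)) := fun j =>
          (hnet.measurable_count (fun k => (k : ℝ≥0∞)) ε j).mul
            (hnet.measurable_loss_prod a ε j j)
        rw [lintegral_const_mul _ (Measurable.tsum hm), lintegral_tsum fun j => (hm j).aemeasurable]
        congr 1
        refine tsum_congr fun j => ?_
        rw [hnet.lintegral_count_mul_loss_prod hlam hα hγ ha0 ha1 hε j j (fun k => (k : ℝ≥0∞))
          (by rw [hcount]; exact ENNReal.ofReal_ne_top), hcount]
    _ ≤ ENNReal.ofReal a * ∑' j : ℕ, ENNReal.ofReal (ε * Real.exp ε * Real.exp (-(j * (ε * C)))) := by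
        gcongr with j
        rw [mul_assoc, ENNReal.ofReal_mul hε.le]
        gcongr
        exact hexp j
    _ = _ := by
        rw [tsum_ofReal_geometric (by positivity) (by positivity), ← ENNReal.ofReal_mul ha0]
        congr 1
        ring

/-- The loss of `exp (-ε)` comes from requiring exactly one point in the annulus, that of `exp (-ε
C)` from using the outer radius, of index `j + 1`. -/
theorem IsNetwork.le_hitProb (hnet : IsNetwork μ lam lamE D p X Φe cache active h)
    (hlam : 0 < lam) (hlamE : 0 ≤ lamE) (hD : 0 ≤ D) (hP : 0 < P) (hα : 2 < α) (hγ : 0 < γ)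
    (i : Fin F) {a : ℝ} (ha : a = p i * Real.exp (-(Real.pi * lamE * D ^ 2))) (ha0 : 0 ≤ a)
    (ha1 : a ≤ 1) {C : ℝ} (hC : C = a * tau1 (2 / α) γ + kappa1 (2 / α) γ) (hC0 : 0 < C)
    {ε : ℝ} (hε : 0 < ε) :
    ENNReal.ofReal (a * Real.exp (-(ε + ε * C)) * (ε / (1 - Real.exp (-(ε * C))))) ≤
      ∫⁻ ω, hitProbGiven μ P α γ cache active h i (fun n => X n ω) ∂μ := by
  have hms : ∀ j, MeasurableSet (annulusIndex lam ε ⁻¹' {j}) := fun j =>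
    measurable_annulusIndex (measurableSet_singleton j)
  have hcount : ∀ j, ∫⁻ ω, (if ((range fun n => X n ω) ∩
      annulusIndex lam ε ⁻¹' {j}).encard = 1 then (1 : ℝ≥0∞) else 0) ∂μ =
      ENNReal.ofReal (ε * Real.exp (-ε)) := fun j => by
    have hfin : (ENNReal.ofReal lam • (volume : Measure Plane)) (annulusIndex lam ε ⁻¹' {j}) ≠ ∞ := by
      rw [intensity_annulus hlam hε j]; exact ENNReal.ofReal_ne_top
    have h1 := hnet.loc_ppp.measure_count_eq_one (hms j) hfin
    rw [intensity_annulus hlam hε j, expNeg_ofReal hε.le, ← ENNReal.ofReal_mul hε.le] at h1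
    rw [← h1, ← lintegral_indicator_one (show MeasurableSet {ω | ((range fun n => X n ω) ∩
      annulusIndex lam ε ⁻¹' {j}).encard = 1} from
        hnet.loc_ppp.measurable_count _ (hms j) (measurableSet_singleton 1))]
    refine lintegral_congr fun ω => ?_
    simp [Set.indicator_apply]
  have hexp : ∀ j : ℕ, ENNReal.ofReal (Real.exp (-(ε * C)) * Real.exp (-(j * (ε * C)))) ≤
      expNeg (∫⁻ y, offClassLoss a α γ (annulusIndex lam ε) j (innerRadius lam ε (j + 1)) y
        ∂(ENNReal.ofReal lam • (volume : Measure Plane))) := fun j => by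
    have h1 := antitone_expNeg (lintegral_offClassLoss_le ha0 hα hγ hlam hε j (j + 1))
    rw [← hC, expNeg_ofReal (by positivity)] at h1
    refine le_trans (le_of_eq ?_) h1
    rw [← Real.exp_add]
    congr 2
    push_cast
    ring
  calc _ = ENNReal.ofReal a * ∑' j : ℕ, ENNReal.ofReal
        (ε * Real.exp (-ε) * Real.exp (-(ε * C)) * Real.exp (-(j * (ε * C)))) := by
        rw [tsum_ofReal_geometric (by positivity) (by positivity), ← ENNReal.ofReal_mul ha0]
        congr 1
        rw [neg_add, Real.exp_add]
        ring
    _ ≤ ENNReal.ofReal a * ∑' j : ℕ, ENNReal.ofReal (ε * Real.exp (-ε)) *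
        expNeg (∫⁻ y, offClassLoss a α γ (annulusIndex lam ε) j (innerRadius lam ε (j + 1)) y
          ∂(ENNReal.ofReal lam • (volume : Measure Plane))) := by
        gcongr with j
        rw [mul_assoc (ε * Real.exp (-ε)), ENNReal.ofReal_mul (by positivity)]
        gcongr
        exact hexp j
    _ = ∫⁻ ω, ENNReal.ofReal a * ∑' j,
        (if ((range fun n => X n ω) ∩ annulusIndex lam ε ⁻¹' {j}).encard = 1 then 1 else 0) *
        (infProd fun n => 1 - offClassLoss a α γ (annulusIndex lam ε) j
          (innerRadius lam ε (j + 1)) (X n ω)) ∂μ := by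
        have hm : ∀ j, Measurable fun ω =>
            (if ((range fun n => X n ω) ∩ annulusIndex lam ε ⁻¹' {j}).encard = 1 then
              (1 : ℝ≥0∞) else 0) *
            (infProd fun n => 1 - offClassLoss a α γ (annulusIndex lam ε) j
              (innerRadius lam ε (j + 1)) (X n ω)) := fun j =>
          (hnet.measurable_count (fun k => if k = 1 then 1 else 0) ε j).mul
            (hnet.measurable_loss_prod a ε j (j + 1))
        rw [lintegral_const_mul _ (Measurable.tsum hm), lintegral_tsum fun j => (hm j).aemeasurable]
        congr 1
        refine tsum_congr fun j => ?_
        rw [hnet.lintegral_count_mul_loss_prod hlam hα hγ ha0 ha1 hε j (j + 1)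
          (fun k => if k = 1 then 1 else 0)
          (by rw [hcount]; exact ENNReal.ofReal_ne_top), hcount]
    _ ≤ _ := by
        refine lintegral_mono_ae ?_
        filter_upwards [hnet.ae_ne_zero, hnet.loc_injective] with ω h0 hinj
        exact hnet.le_hitProbGiven hlam hlamE hD hP (by linarith) hγ i ha ha0 ha1 hε h0 hinj

theorem kappa2_nonneg {δ : ℝ} (hδ : 0 < δ) (hδ1 : δ < 1) (hγ : 0 < γ) : 0 ≤ kappa2 δ γ := by
  rw [kappa2_eq_integral hδ1 hγ]
  have : 0 ≤ ∫ x in Ioc (0 : ℝ) 1, x ^ (-δ) / (1 + γ * x) :=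
    setIntegral_nonneg measurableSet_Ioc fun x hx => by
      have := hx.1
      positivity
  positivity

/-- The conditional hit probability of a file. -/
theorem IsNetwork.condHitProbability_eq (hnet : IsNetwork μ lam lamE D p X Φe cache active h)
    (hlam : 0 < lam) (hlamE : 0 ≤ lamE) (hD : 0 ≤ D) (hP : 0 < P) (hα : 2 < α) (hγ : 0 < γ)
    (i : Fin F) :
    condHitProbability μ P α γ X cache active h i =
      p i / (tau1 (2 / α) γ * p i + tau2 (2 / α) lamE D γ) := by
  have hδ : 0 < 2 / α := by positivity
  have hδ1 : 2 / α < 1 := by rw [div_lt_one (by linarith)]; exact hα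
  have hp0 : 0 ≤ p i := by rw [← hnet.cache_prob 0 i]; exact measureReal_nonneg
  have hp1 : p i ≤ 1 := by rw [← hnet.cache_prob 0 i]; exact measureReal_le_one
  set θ := Real.exp (-(Real.pi * lamE * D ^ 2)) with hθ
  have hθ0 : 0 < θ := Real.exp_pos _
  have hθ1 : θ ≤ 1 := by
    rw [hθ, Real.exp_le_one_iff, neg_nonpos]
    have := Real.pi_pos
    positivity
  obtain ⟨a, ha⟩ : ∃ a, a = p i * θ := ⟨_, rfl⟩
  obtain ⟨C, hC⟩ : ∃ C, C = a * tau1 (2 / α) γ + kappa1 (2 / α) γ := ⟨_, rfl⟩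
  have ha0 : 0 ≤ a := by rw [ha]; positivity
  have ha1 : a ≤ 1 := by rw [ha]; exact mul_le_one₀ hp1 hθ0.le hθ1
  have hκ1 := kappa1_pos hδ hδ1 hγ
  have hκ2 := kappa2_nonneg hδ hδ1 hγ
  -- `C = a + a κ₂ + (1 - a) κ₁`, with all terms nonnegative and `κ₁ > 0`.
  have hC0 : 0 < C := by
    rw [hC, tau1]
    rcases ha0.eq_or_lt with h0 | h0
    · rw [← h0]; simpa using hκ1
    · nlinarith [mul_nonneg ha0 hκ2, mul_nonneg (sub_nonneg.2 ha1) hκ1.le]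
  have hval : ∫⁻ ω, hitProbGiven μ P α γ cache active h i (fun n => X n ω) ∂μ =
      ENNReal.ofReal (a / C) := by
    have hlim := tendsto_div_one_sub_exp hC0
    have hexp : ∀ c : ℝ, Tendsto (fun ε : ℝ => Real.exp (c * ε)) (𝓝[>] 0) (𝓝 1) := fun c => by
      have : Continuous fun ε : ℝ => Real.exp (c * ε) := by fun_prop
      simpa using (this.tendsto 0).mono_left nhdsWithin_le_nhds
    -- The two bounds differ only in the exponential prefactor: `c = 1` above and `c = -(1 + C)`
    -- below.
    have hlim' : ∀ c : ℝ, Tendsto (fun ε : ℝ => ENNReal.ofReal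
        (a * Real.exp (c * ε) * (ε / (1 - Real.exp (-(ε * C)))))) (𝓝[>] 0)
        (𝓝 (ENNReal.ofReal (a / C))) := fun c => by
      have h := ENNReal.tendsto_ofReal (((hexp c).const_mul a).mul hlim)
      rwa [mul_one, mul_one_div] at h
    refine le_antisymm (ge_of_tendsto (hlim' 1) ?_) (le_of_tendsto (hlim' (-(1 + C))) ?_)
    · filter_upwards [self_mem_nhdsWithin] with ε hε
      rw [one_mul]
      exact hnet.hitProb_le hlam hlamE hD hP hα hγ i ha ha0 ha1 hC hC0 hε
    · filter_upwards [self_mem_nhdsWithin] with ε hε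
      rw [show -(1 + C) * ε = -(ε + ε * C) by ring]
      exact hnet.le_hitProb hlam hlamE hD hP hα hγ i ha ha0 ha1 hC hC0 hε
  have h1 : condHitProbability μ P α γ X cache active h i = a / C := by
    rw [← ENNReal.toReal_ofReal (show 0 ≤ a / C by positivity), ← hval,
      ← hnet.measure_hit_eq_lintegral i]
    rfl
  have h2 : Real.exp (Real.pi * lamE * D ^ 2) = θ⁻¹ := by
    rw [hθ, Real.exp_neg, inv_inv]
  -- Dividing `C = p i θ τ₁ + κ₁` by `θ` moves the activity probability into `τ₂`.
  have h3 : tau1 (2 / α) γ * p i + tau2 (2 / α) lamE D γ = C / θ := by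
    rw [tau2, h2, hC, ha]
    field_simp
  rw [h1, h3, ha]
  field_simp

end Network

end CacheNet
end

theorem theorem1 {Ω : Type*} [MeasurableSpace Ω] (μ : Measure Ω) [IsProbabilityMeasure μ]
    {F : ℕ} (lam lamE D P α γu : ℝ) (hlam : 0 < lam) (hlamE : 0 ≤ lamE) (hD : 0 ≤ D)
    (hP : 0 < P) (hα : 2 < α) (hγu : 0 < γu)
    (p q : Fin F → ℝ) (hq : ∀ i, 0 ≤ q i) (hq_sum : ∑ i, q i = 1)
    (X : ℕ → Ω → CacheNet.Plane) (Φe : Ω → Set CacheNet.Plane)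
    (cache : ℕ → Ω → Set (Fin F)) (active : ℕ → Ω → Bool) (h : ℕ → Ω → ℝ)
    (hnet : CacheNet.IsNetwork μ lam lamE D p X Φe cache active h) :
    CacheNet.hitProbability μ P α γu X cache active h q =
      ∑ i, q i * (p i /
        (CacheNet.tau1 (2 / α) γu * p i + CacheNet.tau2 (2 / α) lamE D γu)) := by
  unfold CacheNet.hitProbability
  simp_rw [hnet.condHitProbability_eq hlam hlamE hD hP hα hγu]
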